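/- Let $K$ be a field and let $G$ be a finite simple graph with $m$ edges. For an edge $e=\{a,b\}$ put $M_e := x_ax_b \in K[x_v : v \in V(G)]$, and let $I(G)$ be the edge ideal, generated by all $M_e$. Suppose that $I(G)$ has a linear resolution (its minimal graded free resolution is $2$-linear), and let $[e_1,\dots,e_m]$ be an ordering of the edges of $G$ such that $[M_{e_1},\dots,M_{e_m}]$ is a linear quotient ordering for $I(G)$, i.e. these monomials generate $I(G)$ minimally and for every $1<i\le m$ the colon ideal $(M_{e_1},\dots,M_{e_{i-1}}) : (M_{e_i})$ is generated by forms of degree $1$. Let $I_G$ be the toric ideal of $G$, the kernel of the $K$-algebra map $K[y_1,\dots,y_m]\to K[x_v : v\in V(G)]$, $y_i\mapsto M_{e_i}$, and let $\tau$ be the lexicographic order on $K[y_1,\dots,y_m]$ with $y_1\prec_\tau y_2\prec_\tau\dots\prec_\tau y_m$. Then the reduced Gröbner basis of $I_G$ with respect to $\tau$ (which exists and is unique) is doubly squarefree, i.e. every monomial, leading or trailing, occurring in one of its elements is squarefree. Moreover, each of its elements is a circuit of $I_G$, i.e. an irreducible binomial $y^u-y^v\in I_G$ ($u\neq v$) such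 that no binomial of $I_G$ has its set of variables properly contained in that of $y^u-y^v$. -/

import Mathlib

noncomputable section

namespace EdgeToric

open MvPolynomial

/-! ### Edge ideals, linear resolutions and linear quotients -/

/-- The monomial `x_a x_b` of an unordered pair `{a, b}`. -/
def edgeMonomial (K : Type*) [Field K] {V : Type*} (e : Sym2 V) : MvPolynomial V K :=
  Sym2.lift ⟨fun a b => X a * X b, fun a b => mul_comm (X a) (X b)⟩ e

/-- The edge ideal of `G`, generated by the monomials `x_a x_b` for the edges `{a, b}` of `G`. -/
def edgeIdeal (K : Type*) [Field K] {V : Type*} (G : SimpleGraph V) :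
    Ideal (MvPolynomial V K) :=
  Ideal.span (edgeMonomial K '' G.edgeSet)

/-- The ideal `I` is generated in degree `d` and has a `d`-linear resolution: with
`S = MvPolynomial σ K`, there is an exact complex of graded free modules
`⋯ → S(-d-2)^(b 2) → S(-d-1)^(b 1) → S(-d)^(b 0) → I → 0`.
The augmentation is a row `f` of forms of degree `d`, and each later differential is a matrix
`φ i` of linear forms. Such a resolution is automatically minimal, since all the entries of the
`φ i` lie in the ideal generated by the variables. -/
def HasLinearResolution {K σ : Type*} [Field K] (d : ℕ) (I : Ideal (MvPolynomial σ K)) : Prop :=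
  ∃ (b : ℕ → ℕ) (f : Fin (b 0) → MvPolynomial σ K)
    (φ : ∀ i : ℕ, Matrix (Fin (b i)) (Fin (b (i + 1))) (MvPolynomial σ K)),
    (∀ j, (f j).IsHomogeneous d) ∧
    (∀ i j k, (φ i j k).IsHomogeneous 1) ∧
    Ideal.span (Set.range f) = I ∧
    (∀ v : Fin (b 0) → MvPolynomial σ K, f ⬝ᵥ v = 0 ↔ ∃ w, (φ 0).mulVec w = v) ∧
    (∀ (i : ℕ) (v : Fin (b (i + 1)) → MvPolynomial σ K),
      (φ i).mulVec v = 0 ↔ ∃ w, (φ (i + 1)).mulVec w = v)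

/-- `[f 0, …, f (s - 1)]` is a linear quotient ordering for `I`: these elements generate `I`
minimally, and every colon ideal `(f 0, …, f (i - 1)) : (f i)` with `i > 0` is generated by
forms of degree one. -/
def IsLinearQuotientOrdering {K σ : Type*} [Field K] {s : ℕ} (I : Ideal (MvPolynomial σ K))
    (f : Fin s → MvPolynomial σ K) : Prop :=
  Ideal.span (Set.range f) = I ∧
  (∀ i, f i ∉ Ideal.span (f '' {j | j ≠ i})) ∧
  ∀ i : Fin s, 0 < (i : ℕ) →
    ∃ L : Set (MvPolynomial σ K), (∀ l ∈ L, l.IsHomogeneous 1) ∧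
      (Ideal.span (f '' {j | j < i})).colon {f i} = Ideal.span L

/-! ### The toric ideal -/

/-- The toric ideal of `G` with respect to an enumeration `e` of its edges: the kernel of
the `K`-algebra map `K[y_0, …, y_(m-1)] → K[V]` that sends `y_i` to the monomial of `e i`. -/
def toricIdeal (K : Type*) [Field K] {V : Type*} {G : SimpleGraph V} {m : ℕ}
    (e : Fin m ≃ G.edgeSet) : Ideal (MvPolynomial (Fin m) K) :=
  RingHom.ker (aeval (fun i => edgeMonomial K (e i : Sym2 V)) :
    MvPolynomial (Fin m) K →ₐ[K] MvPolynomial V K)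

/-! ### The lexicographic order -/

/-- The lexicographic order on the monomials in `y_0, …, y_(m-1)` with `y_0 ≺ ⋯ ≺ y_(m-1)`. -/
def lexAscending (m : ℕ) : MonomialOrder (Fin m) where
  syn := Lex ((Fin m)ᵒᵈ →₀ ℕ)
  toSyn := (Finsupp.domCongr OrderDual.toDual).trans
    { toEquiv := toLex, map_add' := toLex_add }
  toSyn_monotone := fun _ _ h => Finsupp.toLex_monotone fun i => h (OrderDual.ofDual i)

open scoped MonomialOrder in
/-- Two monomials are compared at the largest variable in which their exponents differ. -/
theorem lexAscending_lt_iff {m : ℕ} (u v : Fin m →₀ ℕ) :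
    u ≺[lexAscending m] v ↔ ∃ i, (∀ j, i < j → u j = v j) ∧ u i < v i :=
  Iff.rfl

/-! ### Reduced Gröbner bases -/

/-- The initial ideal of `I`, generated by the leading terms of its elements. -/
def initialIdeal {K σ : Type*} [Field K] (τ : MonomialOrder σ) (I : Ideal (MvPolynomial σ K)) :
    Ideal (MvPolynomial σ K) :=
  Ideal.span (τ.leadingTerm '' (I : Set (MvPolynomial σ K)))

/-- `B` is a reduced Gröbner basis of `I` with respect to `τ`: it consists of monic elements
of `I`, their leading terms minimally generate the initial ideal, and no trailing term of an
element of `B` lies in the initial ideal. -/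
structure IsReducedGroebnerBasis {K σ : Type*} [Field K] (τ : MonomialOrder σ)
    (I : Ideal (MvPolynomial σ K)) (B : Set (MvPolynomial σ K)) : Prop where
  finite : B.Finite
  subset : B ⊆ I
  monic : ∀ b ∈ B, τ.Monic b
  span_leadingTerm : Ideal.span (τ.leadingTerm '' B) = initialIdeal τ I
  minimal : ∀ b ∈ B, τ.leadingTerm b ∉ Ideal.span (τ.leadingTerm '' (B \ {b}))
  trailing : ∀ b ∈ B, ∀ u ∈ b.support, u ≠ τ.degree b →
    monomial u (1 : K) ∉ initialIdeal τ I

/-- All monomials, leading and trailing, that occur in elements of `B` are squarefree. -/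
def IsDoublySquarefree {K σ : Type*} [Field K] (B : Set (MvPolynomial σ K)) : Prop :=
  ∀ b ∈ B, ∀ u ∈ b.support, ∀ i, u i ≤ 1

/-! ### Circuits -/

/-- A (nonzero, pure difference) binomial `y^u - y^v`. -/
def IsBinomial {K σ : Type*} [Field K] (b : MvPolynomial σ K) : Prop :=
  ∃ u v : σ →₀ ℕ, u ≠ v ∧ b = monomial u 1 - monomial v 1

/-- `b` is a circuit of `I`: an irreducible binomial of `I` such that no binomial of `I` has
its variables properly contained in those of `b`. -/
def IsCircuit {K σ : Type*} [Field K] (I : Ideal (MvPolynomial σ K)) (b : MvPolynomial σ K) :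
    Prop :=
  b ∈ I ∧ IsBinomial b ∧ Irreducible b ∧ ∀ b' ∈ I, IsBinomial b' → ¬ b'.vars ⊂ b.vars

end EdgeToric

end

/-! The reduced Gröbner basis consists of the binomials `y^u - y^v` with `u` a minimal nonstandard
exponent and `v` the standard exponent in its fibre. By minimality `u` and `v` are coprime, so the
largest variable `y_M` involved divides only `y^u`, and the edges of `u` and `v` can be arranged in
one closed walk, alternately from `u` and from `v`, starting with `M`
(`IsMinimalNonstandard.exists_isTightWalk`). This walk has two rigidity properties. No proper part
of it is balanced. A part containing `M` that becomes balanced after adding one edge below `M` is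
nonstandard, hence uses all of `u`.

Linear quotients say that two disjoint edges are joined by an edge smaller than the larger of them
(`IsLinearQuotientOrdering.hasJoiningEdges`). If a vertex occurs at an even and at an odd position,
both away from `M`, then `M` is disjoint from the second edge of the odd closed subwalk between the
two visits. Each of the four possible joining edges is below `M` and closes up a proper part of the
walk, a contradiction. A similar argument shows that the endpoints of `M` are not both repeated. So
at most one vertex is repeated (`IsTightWalk.even_index_unique`): the walk is an even cycle or two
odd cycles sharing a vertex.

Hence the edges of the walk are distinct, which makes both monomials squarefree. Their integral
relations form a group of rank one (`IsTightWalk.coeff_eq`), which makes the binomial a circuit. -/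

namespace EdgeToric

open Finset

/-! ### Tight walks and the joining property -/

/-- The indicator function of a vertex. -/
noncomputable def vertexIndicator {V : Type*} (x : V) : V → ℤ :=
  letI := Classical.decEq V
  Pi.single x 1

/-- A closed walk `p 0, r 0, p 1, r 1, …, p q = p 0` whose edges are alternately the `α k` and the
`β k`, whose largest edge is `α 0`, which has no proper balanced part, and none of whose parts
containing `α 0` can be balanced with the help of a smaller edge. -/
structure IsTightWalk {V : Type*} {m : ℕ} (ed : Fin m → Sym2 V) (q : ℕ) (p r : ℕ → V)
    (α β : ℕ → Fin m) : Prop where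
  pos : 0 < q
  closed : p q = p 0
  edge_left : ∀ k < q, ed (α k) = s(p k, r k)
  edge_right : ∀ k < q, ed (β k) = s(r k, p (k + 1))
  left_le : ∀ k < q, α k ≤ α 0
  right_lt : ∀ k < q, β k < α 0
  primitive : ∀ S T : Finset ℕ, S ⊆ range q → T ⊆ range q → S.Nonempty →
    ∑ k ∈ S, (vertexIndicator (p k) + vertexIndicator (r k)) =
      ∑ k ∈ T, (vertexIndicator (r k) + vertexIndicator (p (k + 1))) → S = range q
  minimal : ∀ S T : Finset ℕ, S ⊆ range q → T ⊆ range q → 0 ∈ S → ∀ h < α 0, ∀ x y,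
    ed h = s(x, y) →
    ∑ k ∈ S, (vertexIndicator (p k) + vertexIndicator (r k)) =
      ∑ k ∈ T, (vertexIndicator (r k) + vertexIndicator (p (k + 1))) +
        (vertexIndicator x + vertexIndicator y) → S = range q

/-- The combinatorial form of linear quotients: an edge and a smaller disjoint edge are joined by
an edge smaller than the first. -/
def HasJoiningEdges {V : Type*} {m : ℕ} (ed : Fin m → Sym2 V) : Prop :=
  ∀ j i, j < i → (∀ x, x ∈ ed j → x ∉ ed i) →
    ∃ k < i, ∃ a b, a ∈ ed j ∧ b ∈ ed i ∧ ed k = s(a, b)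

/-- Whichever of the two edges is larger, the joining edge lies strictly below it, hence below any
common bound. In the applications `N` is the largest edge of the walk. -/
theorem HasJoiningEdges.exists_of_le {V : Type*} {m : ℕ} {ed : Fin m → Sym2 V}
    (H : HasJoiningEdges ed) {i j N : Fin m} {a b c d : V} (hi : i ≤ N) (hj : j ≤ N)
    (ei : ed i = s(a, b)) (ej : ed j = s(c, d)) (h1 : a ≠ c) (h2 : a ≠ d) (h3 : b ≠ c)
    (h4 : b ≠ d) :
    ∃ k < N, ed k = s(a, c) ∨ ed k = s(a, d) ∨ ed k = s(b, c) ∨ ed k = s(b, d) := by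
  rcases lt_trichotomy i j with hij | hij | hij
  · obtain ⟨k, hk, x, y, hx, hy, e⟩ := H i j hij (by
      rw [ei, ej]; intro x; simp only [Sym2.mem_iff]; rintro (rfl | rfl) <;> tauto)
    rw [ei, Sym2.mem_iff] at hx
    rw [ej, Sym2.mem_iff] at hy
    refine ⟨k, hk.trans_le hj, ?_⟩
    rcases hx with rfl | rfl <;> rcases hy with rfl | rfl <;> tauto
  · subst hij
    rw [ei, Sym2.eq_iff] at ej
    tauto
  · obtain ⟨k, hk, x, y, hx, hy, e⟩ := H j i hij (by
      rw [ei, ej]; intro x; simp only [Sym2.mem_iff]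
      rintro (rfl | rfl) <;> push Not <;> exact ⟨Ne.symm ‹_›, Ne.symm ‹_›⟩)
    rw [ei, Sym2.mem_iff] at hy
    rw [ej, Sym2.mem_iff] at hx
    rw [Sym2.eq_swap] at e
    refine ⟨k, hk.trans_le hi, ?_⟩
    rcases hx with rfl | rfl <;> rcases hy with rfl | rfl <;> tauto

/-! ### Telescoping along a walk -/

section Telescoping

variable {A : Type*} [AddCommGroup A] (P R : ℕ → A)

/-- With `P`, `R` the indicators of the even and odd vertices, the sums are the degrees of blocks of
left and right edges; interior vertices cancel and only the two ends of the subwalk remain. -/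
theorem sum_sub_sum_Ico {i j : ℕ} (h : i ≤ j) :
    ∑ k ∈ Ico i j, (P k + R k) = ∑ k ∈ Ico i j, (R k + P (k + 1)) + P i - P j := by
  induction j, h using Nat.le_induction with
  | base => simp
  | succ n hn ih => rw [sum_Ico_succ_top hn, sum_Ico_succ_top hn, ih]; abel

theorem sum_sub_sum_Ico_succ {i j : ℕ} (h : i ≤ j) :
    ∑ k ∈ Ico (i + 1) (j + 1), (P k + R k) =
      ∑ k ∈ Ico i j, (R k + P (k + 1)) + R j - R i := by
  induction j, h using Nat.le_induction with
  | base => simp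
  | succ n hn ih =>
    rw [sum_Ico_succ_top (by omega), sum_Ico_succ_top hn, ih]; abel

end Telescoping

theorem sum_union_Ico {A : Type*} [AddCommMonoid A] (f : ℕ → A) {a b c d : ℕ} (h : b ≤ c) :
    ∑ k ∈ Ico a b ∪ Ico c d, f k = ∑ k ∈ Ico a b, f k + ∑ k ∈ Ico c d, f k :=
  sum_union (disjoint_left.2 fun x hx hy => by simp only [mem_Ico] at hx hy; omega)

theorem sum_union_union_Ico {A : Type*} [AddCommMonoid A] (f : ℕ → A) {a b c d e g : ℕ}
    (h : b ≤ c) (h' : d ≤ e) (h'' : b ≤ e) :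
    ∑ k ∈ Ico a b ∪ Ico c d ∪ Ico e g, f k =
      ∑ k ∈ Ico a b, f k + ∑ k ∈ Ico c d, f k + ∑ k ∈ Ico e g, f k := by
  rw [sum_union (disjoint_left.2 fun x hx hy => by
    simp only [mem_union, mem_Ico] at hx hy; omega), sum_union_Ico f h]

/-! ### Repeated vertices of a tight walk -/

namespace IsTightWalk

variable {V : Type*} {m : ℕ} {ed : Fin m → Sym2 V} {q : ℕ} {p r : ℕ → V} {α β : ℕ → Fin m}

/-- Primitivity for unions of blocks, the only parts that occur below. The index `c` shows that the
part is nonempty and `k` that it is proper; unneeded blocks are taken to be `Ico q q`. -/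
theorem balanced_Ico (W : IsTightWalk ed q p r α β) (s₁ t₁ s₂ t₂ s₃ t₃ a₁ b₁ a₂ b₂ c k : ℕ)
    (hS : t₁ ≤ s₂ ∧ t₂ ≤ s₃ ∧ t₁ ≤ s₃ ∧ t₁ ≤ q ∧ t₂ ≤ q ∧ t₃ ≤ q)
    (hT : b₁ ≤ a₂ ∧ b₁ ≤ q ∧ b₂ ≤ q)
    (hc : s₁ ≤ c ∧ c < t₁ ∨ s₂ ≤ c ∧ c < t₂ ∨ s₃ ≤ c ∧ c < t₃) (hk : k < q)
    (hk' : ¬ (s₁ ≤ k ∧ k < t₁ ∨ s₂ ≤ k ∧ k < t₂ ∨ s₃ ≤ k ∧ k < t₃)) :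
    ∑ k ∈ Ico s₁ t₁, (vertexIndicator (p k) + vertexIndicator (r k)) +
      ∑ k ∈ Ico s₂ t₂, (vertexIndicator (p k) + vertexIndicator (r k)) +
      ∑ k ∈ Ico s₃ t₃, (vertexIndicator (p k) + vertexIndicator (r k)) ≠
      ∑ k ∈ Ico a₁ b₁, (vertexIndicator (r k) + vertexIndicator (p (k + 1))) +
      ∑ k ∈ Ico a₂ b₂, (vertexIndicator (r k) + vertexIndicator (p (k + 1))) := by
  intro h
  rw [← sum_union_union_Ico _ hS.1 hS.2.1 hS.2.2.1, ← sum_union_Ico _ hT.1] at h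
  have := W.primitive _ _ (fun x hx => by simp only [mem_union, mem_Ico, mem_range] at hx ⊢; omega)
    (fun x hx => by simp only [mem_union, mem_Ico, mem_range] at hx ⊢; omega)
    ⟨c, by simp only [mem_union, mem_Ico]; tauto⟩ h
  have := this ▸ mem_range.2 hk
  simp only [mem_union, mem_Ico] at this
  tauto

/-- The analogue for `minimal`; the first block starts at `0`, so the part contains the largest
edge. -/
theorem minimal_Ico (W : IsTightWalk ed q p r α β) (t₁ s₂ t₂ s₃ t₃ a₁ b₁ a₂ b₂ k : ℕ)
    (hS : t₁ ≤ s₂ ∧ t₂ ≤ s₃ ∧ t₁ ≤ s₃ ∧ t₁ ≤ q ∧ t₂ ≤ q ∧ t₃ ≤ q)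
    (hT : b₁ ≤ a₂ ∧ b₁ ≤ q ∧ b₂ ≤ q)
    (hc : 0 < t₁) (hk : k < q)
    (hk' : ¬ (k < t₁ ∨ s₂ ≤ k ∧ k < t₂ ∨ s₃ ≤ k ∧ k < t₃)) {h : Fin m} (hh : h < α 0) {x y : V}
    (hxy : ed h = s(x, y)) :
    ∑ k ∈ Ico 0 t₁, (vertexIndicator (p k) + vertexIndicator (r k)) +
      ∑ k ∈ Ico s₂ t₂, (vertexIndicator (p k) + vertexIndicator (r k)) +
      ∑ k ∈ Ico s₃ t₃, (vertexIndicator (p k) + vertexIndicator (r k)) ≠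
      ∑ k ∈ Ico a₁ b₁, (vertexIndicator (r k) + vertexIndicator (p (k + 1))) +
      ∑ k ∈ Ico a₂ b₂, (vertexIndicator (r k) + vertexIndicator (p (k + 1))) +
      (vertexIndicator x + vertexIndicator y) := by
  intro e
  rw [← sum_union_union_Ico _ hS.1 hS.2.1 hS.2.2.1, ← sum_union_Ico _ hT.1] at e
  have := W.minimal _ _ (fun x hx => by simp only [mem_union, mem_Ico, mem_range] at hx ⊢; omega)
    (fun x hx => by simp only [mem_union, mem_Ico, mem_range] at hx ⊢; omega)
    (by simp only [mem_union, mem_Ico]; omega) h hh x y hxy e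
  have := this ▸ mem_range.2 hk
  simp only [mem_union, mem_Ico] at this
  omega

theorem even_part (p r : ℕ → V) {i j : ℕ} (h : i ≤ j) :
    ∑ k ∈ Ico i j, (vertexIndicator (p k) + vertexIndicator (r k)) =
      ∑ k ∈ Ico i j, (vertexIndicator (r k) + vertexIndicator (p (k + 1))) +
        vertexIndicator (p i) - vertexIndicator (p j) :=
  sum_sub_sum_Ico (fun k => vertexIndicator (p k)) (fun k => vertexIndicator (r k)) h

theorem odd_part (p r : ℕ → V) {i j : ℕ} (h : i ≤ j) :
    ∑ k ∈ Ico (i + 1) (j + 1), (vertexIndicator (p k) + vertexIndicator (r k)) =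
      ∑ k ∈ Ico i j, (vertexIndicator (r k) + vertexIndicator (p (k + 1))) +
        vertexIndicator (r j) - vertexIndicator (r i) :=
  sum_sub_sum_Ico_succ (fun k => vertexIndicator (p k)) (fun k => vertexIndicator (r k)) h

theorem first_part (p r : ℕ → V) (j : ℕ) :
    ∑ k ∈ Ico 0 (j + 1), (vertexIndicator (p k) + vertexIndicator (r k)) =
      ∑ k ∈ Ico 0 j, (vertexIndicator (r k) + vertexIndicator (p (k + 1))) +
        vertexIndicator (p 0) + vertexIndicator (r j) := by
  rw [sum_Ico_succ_top (Nat.zero_le j), even_part p r (Nat.zero_le j)]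
  abel

theorem last_part (W : IsTightWalk ed q p r α β) {j : ℕ} (h : j < q) :
    ∑ k ∈ Ico (j + 1) q, (vertexIndicator (p k) + vertexIndicator (r k)) =
      ∑ k ∈ Ico j q, (vertexIndicator (r k) + vertexIndicator (p (k + 1)))
        - vertexIndicator (r j) - vertexIndicator (p 0) := by
  rw [even_part p r h, W.closed, sum_eq_sum_Ico_succ_bot h]
  abel

theorem even_last_part (W : IsTightWalk ed q p r α β) {i : ℕ} (h : i ≤ q) :
    ∑ k ∈ Ico i q, (vertexIndicator (p k) + vertexIndicator (r k)) =
      ∑ k ∈ Ico i q, (vertexIndicator (r k) + vertexIndicator (p (k + 1))) +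
        vertexIndicator (p i) - vertexIndicator (p 0) := by
  rw [even_part p r h, W.closed]

/-- A repetition at positions of equal parity would cut out a closed subwalk of even length, which
is balanced. -/
theorem even_ne (W : IsTightWalk ed q p r α β) {i j : ℕ} (hij : i < j) (hj : j < q) :
    p i ≠ p j := by
  intro h
  apply W.balanced_Ico i j q q q q i j q q i j (by omega) (by omega) (by omega) hj (by omega)
  rw [even_part p r hij.le, h]
  simp

theorem odd_ne (W : IsTightWalk ed q p r α β) {i j : ℕ} (hij : i < j) (hj : j < q) :
    r i ≠ r j := by
  intro h
  apply W.balanced_Ico (i + 1) (j + 1) q q q q i j q q j i (by omega) (by omega) (by omega)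
    (by omega) (by omega)
  rw [odd_part p r hij.le, h]
  simp

theorem even_inj (W : IsTightWalk ed q p r α β) {i j : ℕ} (hi : i < q) (hj : j < q)
    (h : p i = p j) : i = j := by
  rcases lt_trichotomy i j with hij | hij | hij
  · exact (W.even_ne hij hj h).elim
  · exact hij
  · exact (W.even_ne hij hi h.symm).elim

theorem odd_inj (W : IsTightWalk ed q p r α β) {i j : ℕ} (hi : i < q) (hj : j < q)
    (h : r i = r j) : i = j := by
  rcases lt_trichotomy i j with hij | hij | hij
  · exact (W.odd_ne hij hj h).elim
  · exact hij
  · exact (W.odd_ne hij hi h.symm).elim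

/-- The subwalk from `p i` through `p q = p 0` to `r j` begins and ends with a left edge, so the
chord balances it. By minimality it contains every left edge, which leaves no gap between `j` and
`i`. -/
theorem chord (W : IsTightWalk ed q p r α β) {i j : ℕ} (hij : j < i) (hi : i ≤ q) {h : Fin m}
    (hh : h < α 0) (e : ed h = s(p i, r j)) : i = j + 1 := by
  by_contra hne
  apply W.minimal_Ico (j + 1) i q q q 0 j i q (j + 1) (by omega) (by omega) (by omega)
    (by omega) (by omega) hh e
  rw [first_part, W.even_last_part hi]
  simp only [Ico_self, sum_empty]
  abel

theorem left_ne (W : IsTightWalk ed q p r α β) (hd : ∀ i, ¬ (ed i).IsDiag) {k : ℕ} (hk : k < q) :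
    p k ≠ r k := by
  have := hd (α k)
  rwa [W.edge_left k hk, Sym2.mk_isDiag_iff] at this

theorem right_ne (W : IsTightWalk ed q p r α β) (hd : ∀ i, ¬ (ed i).IsDiag) {k : ℕ} (hk : k < q) :
    r k ≠ p (k + 1) := by
  have := hd (β k)
  rwa [W.edge_right k hk, Sym2.mk_isDiag_iff] at this

/-- Away from the largest edge, no vertex is visited first at an even and then at an odd
position. -/
theorem not_even_lt_odd (W : IsTightWalk ed q p r α β)
    (H : HasJoiningEdges ed) {i j : ℕ} (hi : 0 < i) (hij : i < j) (hj : j < q)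
    (h : p i = r j) : False := by
  have z₁b : r 0 ≠ r i := W.odd_ne hi (hij.trans hj)
  have z₂a : p 0 ≠ p (i + 1) := W.even_ne (by omega) (by omega)
  have z₁a : p 0 ≠ r i := by
    intro h'
    apply W.balanced_Ico 0 i (i + 1) (j + 1) q q 0 i i j 0 i (by omega) (by omega) (by omega)
      (by omega) (by omega)
    rw [even_part p r (Nat.zero_le i), odd_part p r hij.le, h, h']
    simp only [Ico_self, sum_empty]
    abel
  have z₂b : r 0 ≠ p (i + 1) := by
    intro h'
    apply W.balanced_Ico 0 1 i (i + 1) (j + 1) q i (i + 1) j q 0 j (by omega) (by omega)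
      (by omega) (by omega) (by omega)
    rw [first_part, even_part p r (Nat.le_succ i), W.last_part hj, h, h']
    simp only [Ico_self, sum_empty]
    abel
  -- `β i` is the second edge of the odd closed subwalk from `p i` to `r j`. A joining edge between
  -- opposite parities is a chord; between equal parities, `p i = r j` is what closes up the part.
  obtain ⟨k, hk, e⟩ := H.exists_of_le le_rfl (W.right_lt i (by omega)).le (W.edge_left 0 W.pos)
    (W.edge_right i (by omega)) z₁a z₂a z₁b z₂b
  rcases e with e | e | e | e
  -- `p 0` is read as `p q`, so that the even end of the chord comes after the odd one.
  · have := W.chord (i := q) (j := i) (by omega) le_rfl hk (by rw [W.closed]; exact e)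
    omega
  · apply W.minimal_Ico i (i + 1) (j + 1) q q 0 i (i + 1) j i (by omega) (by omega)
      (by omega) (by omega) (by omega) hk e
    rw [even_part p r (Nat.zero_le i), sum_Ico_succ_top hij,
      even_part p r hij, h]
    simp only [Ico_self, sum_empty]
    abel
  · apply W.minimal_Ico 1 i (i + 1) (j + 1) q j q q q j (by omega) (by omega)
      (by omega) (by omega) (by omega) hk e
    rw [first_part, W.last_part hj, Nat.Ico_succ_singleton, sum_singleton, h]
    simp only [Ico_self, sum_empty]
    abel
  · have := W.chord (i := i + 1) (j := 0) (by omega) (by omega) hk (by rw [e, Sym2.eq_swap])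
    omega

/-- Away from the largest edge, no vertex is visited first at an odd and then at an even
position. -/
theorem not_odd_lt_even (W : IsTightWalk ed q p r α β) (hd : ∀ i, ¬ (ed i).IsDiag)
    (H : HasJoiningEdges ed) {i j : ℕ} (hj : 0 < j) (hij : j < i) (hi : i < q)
    (h : p i = r j) : False := by
  have hne : i ≠ j + 1 := by
    rintro rfl
    exact W.right_ne hd (by omega) h.symm
  have hij' : j + 1 < i := by omega
  have z₁a : p 0 ≠ p (j + 1) := W.even_ne (by omega) (by omega)
  have z₂b : r 0 ≠ r (j + 1) := W.odd_ne (by omega) (by omega)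
  have z₁b : r 0 ≠ p (j + 1) := by
    intro h'
    apply W.balanced_Ico 1 (j + 1) (j + 1) i q q 0 j (j + 1) i (j + 1) 0 (by omega) (by omega)
      (by omega) (by omega) (by omega)
    rw [odd_part p r (Nat.zero_le j), even_part p r hij, h, h']
    simp only [Ico_self, sum_empty]
    abel
  have z₂a : p 0 ≠ r (j + 1) := by
    intro h'
    apply W.balanced_Ico (j + 1) (j + 2) i q q q j (j + 1) i q (j + 1) 0 (by omega) (by omega)
      (by omega) (by omega) (by omega)
    rw [odd_part p r (Nat.le_succ j), W.even_last_part hi.le, h, h']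
    simp only [Ico_self, sum_empty]
    abel
  -- Again the second edge of the odd closed subwalk, now from `r j` to `p i`.
  obtain ⟨k, hk, e⟩ := H.exists_of_le le_rfl (W.left_le (j + 1) (by omega)) (W.edge_left 0 W.pos)
    (W.edge_left (j + 1) (by omega)) z₁a z₂a z₁b z₂b
  rcases e with e | e | e | e
  · apply W.minimal_Ico (j + 1) (j + 1) i q q 0 j (j + 1) i i (by omega) (by omega)
      (by omega) (by omega) (by omega) hk e
    rw [first_part, even_part p r hij, h]
    simp only [Ico_self, sum_empty]
    abel
  · have := W.chord (i := q) (j := j + 1) (by omega) le_rfl hk (by rw [W.closed]; exact e)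
    omega
  · have := W.chord (i := j + 1) (j := 0) (by omega) (by omega) hk (by rw [e, Sym2.eq_swap])
    omega
  · apply W.minimal_Ico 1 (j + 1) (j + 2) i q j (j + 1) i q j (by omega) (by omega)
      (by omega) (by omega) (by omega) hk e
    rw [first_part, odd_part p r (Nat.le_succ j), W.even_last_part hi.le, h]
    simp only [Ico_self, sum_empty]
    abel

/-- A vertex visited at an even and at an odd position lies on the largest edge. -/
theorem eq_zero_or_eq_zero (W : IsTightWalk ed q p r α β) (hd : ∀ i, ¬ (ed i).IsDiag)
    (H : HasJoiningEdges ed) {i j : ℕ} (hi : i < q) (hj : j < q) (h : p i = r j) :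
    i = 0 ∨ j = 0 := by
  by_contra! h0
  rcases lt_trichotomy i j with hij | rfl | hij
  · exact W.not_even_lt_odd H (by omega) hij hj h
  · exact W.left_ne hd hi h
  · exact W.not_odd_lt_even hd H (by omega) hij hi h

/-- The endpoints of the largest edge are not both visited twice. -/
theorem not_both (W : IsTightWalk ed q p r α β) (hd : ∀ i, ¬ (ed i).IsDiag)
    (H : HasJoiningEdges ed) {i j : ℕ} (hi : i < q) (hj : j < q) (ha : p 0 = r j)
    (hb : p i = r 0) : False := by
  have hi0 : i ≠ 0 := by rintro rfl; exact W.left_ne hd W.pos hb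
  have hj0 : j ≠ 0 := by rintro rfl; exact W.left_ne hd W.pos ha
  by_cases hij : j < i
  · apply W.balanced_Ico 1 (j + 1) i q q q 0 j i q 1 0 (by omega) (by omega) (by omega)
      W.pos (by omega)
    rw [odd_part p r (Nat.zero_le j), W.even_last_part hi.le, ha, hb]
    simp only [Ico_self, sum_empty]
    abel
  -- Now `i ≤ j`. The right edge entering `p i` and the one leaving `r j` are disjoint and below `α
  -- 0`; with `p 0 = r j` and `p i = r 0`, each edge joining them becomes a forbidden chord.
  obtain ⟨l, rfl⟩ : ∃ l, i = l + 1 := ⟨i - 1, by omega⟩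
  have hjq : j + 1 < q := by
    rcases (by omega : j + 1 < q ∨ j + 1 = q) with h | rfl
    · exact h
    · exact (W.right_ne hd (Nat.lt_succ_self j) (by rw [W.closed, ha])).elim
  have hzy : p (j + 1) ≠ r l := by
    intro h
    rcases W.eq_zero_or_eq_zero hd H hjq (by omega) h with h' | rfl
    · omega
    · have := W.even_inj hi hjq (hb.trans h.symm)
      omega
  have hay : r j ≠ r l := (W.odd_ne (by omega) hj).symm
  have hzb : p (j + 1) ≠ p (l + 1) := (W.even_ne (by omega) hjq).symm
  have hab : r j ≠ p (l + 1) := by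
    rw [← ha]
    exact W.even_ne (by omega) hi
  obtain ⟨k, hk, e⟩ := H.exists_of_le (W.right_lt j hj).le (W.right_lt l (by omega)).le
    (W.edge_right j hj) (W.edge_right l (by omega)) hay hab hzy hzb
  rcases e with e | e | e | e
  · rw [← ha, ← W.closed] at e
    have := W.chord (by omega) le_rfl hk e
    omega
  · rw [← ha, ← W.closed, hb] at e
    have := W.chord W.pos le_rfl hk e
    omega
  · have := W.chord (by omega) hjq.le hk e
    omega
  · rw [hb] at e
    have := W.chord (by omega) hjq.le hk e
    omega

/-- At most one vertex is visited twice. -/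
theorem even_index_unique (W : IsTightWalk ed q p r α β) (hd : ∀ i, ¬ (ed i).IsDiag)
    (H : HasJoiningEdges ed) {i j k l : ℕ} (hi : i < q) (hj : j < q) (hk : k < q) (hl : l < q)
    (hij : p i = r j) (hkl : p k = r l) : i = k := by
  rcases W.eq_zero_or_eq_zero hd H hi hj hij with rfl | rfl <;>
    rcases W.eq_zero_or_eq_zero hd H hk hl hkl with rfl | rfl
  · rfl
  · exact (W.not_both hd H hk hj hij hkl).elim
  · exact (W.not_both hd H hi hl hkl hij).elim
  · exact W.even_inj hi hk (hij.trans hkl.symm)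

/-- If equal edges were traversed in opposite directions, both endpoints would be repeated vertices,
but at most one vertex is repeated. -/
theorem left_injOn (W : IsTightWalk ed q p r α β) (hd : ∀ i, ¬ (ed i).IsDiag)
    (H : HasJoiningEdges ed) {i j : ℕ} (hi : i < q) (hj : j < q) (h : α i = α j) : i = j := by
  have := W.edge_left i hi
  rw [h, W.edge_left j hj, Sym2.eq_iff] at this
  rcases this with ⟨h, -⟩ | ⟨h, h'⟩
  · exact W.even_inj hi hj h.symm
  · exact W.even_index_unique hd H hi hj hj hi h'.symm h

theorem exists_even_eq (W : IsTightWalk ed q p r α β) {i : ℕ} (hi : i < q) :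
    ∃ k < q, p k = p (i + 1) ∧ (k = i + 1 ∨ k = 0 ∧ i + 1 = q) := by
  rcases (by omega : i + 1 < q ∨ i + 1 = q) with h | h
  · exact ⟨i + 1, h, rfl, Or.inl rfl⟩
  · exact ⟨0, W.pos, by rw [h, W.closed], Or.inr ⟨rfl, h⟩⟩

theorem right_injOn (W : IsTightWalk ed q p r α β) (hd : ∀ i, ¬ (ed i).IsDiag)
    (H : HasJoiningEdges ed) {i j : ℕ} (hi : i < q) (hj : j < q) (h : β i = β j) : i = j := by
  have := W.edge_right i hi
  rw [h, W.edge_right j hj, Sym2.eq_iff] at this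
  rcases this with ⟨h, -⟩ | ⟨h, h'⟩
  · exact W.odd_inj hi hj h.symm
  · obtain ⟨i', hi', hpi, hi''⟩ := W.exists_even_eq hi
    obtain ⟨j', hj', hpj, hj''⟩ := W.exists_even_eq hj
    have := W.even_index_unique hd H hi' hj hj' hi (hpi.trans h.symm) (hpj.trans h')
    omega

end IsTightWalk
end EdgeToric

/-! ### Linear relations among vertex indicators -/

namespace EdgeToric

open Finset

theorem vertexIndicator_self {V : Type*} (x : V) : vertexIndicator x x = 1 := by
  simp [vertexIndicator]

theorem vertexIndicator_of_ne {V : Type*} {x y : V} (h : y ≠ x) : vertexIndicator x y = 0 := by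
  simp [vertexIndicator, h]

theorem sum_mul_vertexIndicator {V : Type*} {q : ℕ} {P : ℕ → V}
    (hP : ∀ i < q, ∀ j < q, P i = P j → i = j) (a : ℕ → ℤ) {i : ℕ} (hi : i < q) :
    ∑ k ∈ range q, a k * vertexIndicator (P k) (P i) = a i := by
  rw [sum_eq_single_of_mem i (mem_range.2 hi), vertexIndicator_self, mul_one]
  intro j hj hji
  rw [vertexIndicator_of_ne, mul_zero]
  exact fun h => hji (hP _ (mem_range.1 hj) _ hi h.symm)

theorem sum_mul_vertexIndicator_eq_zero {V : Type*} {q : ℕ} {P : ℕ → V} (a : ℕ → ℤ) {x : V}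
    (hx : ∀ i < q, x ≠ P i) : ∑ k ∈ range q, a k * vertexIndicator (P k) x = 0 :=
  sum_eq_zero fun j hj => by rw [vertexIndicator_of_ne (hx j (mem_range.1 hj)), mul_zero]

/-- Two families of vertices with at most one common member satisfy no linear relation in which
the coefficients of both families have the same sum. -/
theorem coeff_eq_zero_of_sum_eq_zero {V : Type*} {q : ℕ} {P R : ℕ → V}
    (hP : ∀ i < q, ∀ j < q, P i = P j → i = j) (hR : ∀ i < q, ∀ j < q, R i = R j → i = j)
    (hPR : ∀ i < q, ∀ j < q, ∀ k < q, ∀ l < q, P i = R j → P k = R l → i = k)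
    {a b : ℕ → ℤ} (hab : ∑ k ∈ range q, a k = ∑ k ∈ range q, b k)
    (h : ∀ x, ∑ k ∈ range q, a k * vertexIndicator (P k) x +
      ∑ k ∈ range q, b k * vertexIndicator (R k) x = 0) :
    ∀ k < q, a k = 0 ∧ b k = 0 := by
  have ha : ∀ k < q, (∀ l < q, P k ≠ R l) → a k = 0 := fun k hk hkl => by
    have := h (P k)
    rwa [sum_mul_vertexIndicator hP a hk, sum_mul_vertexIndicator_eq_zero b hkl, add_zero] at this
  have hb : ∀ k < q, (∀ l < q, P l ≠ R k) → b k = 0 := fun k hk hkl => by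
    have := h (R k)
    rwa [sum_mul_vertexIndicator hR b hk, sum_mul_vertexIndicator_eq_zero a
      fun i hi => (hkl i hi).symm, zero_add] at this
  by_cases hex : ∃ i < q, ∃ j < q, P i = R j
  · obtain ⟨i, hi, j, hj, hij⟩ := hex
    have ha' : ∀ k < q, k ≠ i → a k = 0 := fun k hk hki =>
      ha k hk fun l hl e => hki (hPR k hk l hl i hi j hj e hij)
    have hb' : ∀ k < q, k ≠ j → b k = 0 := fun k hk hkj =>
      hb k hk fun l hl e => hkj (hR k hk j hj (by
        rw [← e, ← hij, hPR l hl k hk i hi j hj e hij]))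
    -- At the common vertex only `a i + b j = 0` is known. Equality of the coefficient sums adds `a
    -- i = b j`, and both vanish since 2 is not a zero divisor in `ℤ`.
    have hi0 : a i + b j = 0 := by
      have := h (P i)
      rw [sum_mul_vertexIndicator hP a hi, hij, sum_mul_vertexIndicator hR b hj] at this
      exact this
    rw [sum_eq_single_of_mem i (mem_range.2 hi) fun k hk => ha' k (mem_range.1 hk),
      sum_eq_single_of_mem j (mem_range.2 hj) fun k hk => hb' k (mem_range.1 hk)] at hab
    intro k hk
    constructor
    · by_cases hki : k = i
      · subst hki; omega
      · exact ha' k hk hki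
    · by_cases hkj : k = j
      · subst hkj; omega
      · exact hb' k hk hkj
  · push Not at hex
    exact fun k hk => ⟨ha k hk fun l hl => hex k hk l hl, hb k hk fun l hl => hex l hl k hk⟩

/-! ### Degree sequences and alternating walks -/

/-- The exponent of the monomial of an edge. -/
noncomputable def edgeExponent {V : Type*} (e : Sym2 V) : V →₀ ℕ :=
  Sym2.lift ⟨fun a b => Finsupp.single a 1 + Finsupp.single b 1, fun _ _ => add_comm _ _⟩ e

@[simp]
theorem edgeExponent_mk {V : Type*} (a b : V) :
    edgeExponent s(a, b) = Finsupp.single a 1 + Finsupp.single b 1 := rfl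

theorem mem_of_edgeExponent_ne_zero {V : Type*} {e : Sym2 V} {x : V} (h : edgeExponent e x ≠ 0) :
    x ∈ e := by
  induction e with
  | h a b =>
    by_contra hx
    rw [Sym2.mem_iff, not_or] at hx
    exact h (by simp [Finsupp.single_eq_of_ne hx.1, Finsupp.single_eq_of_ne hx.2])

/-- The degree sequence of a multiset of edges. -/
noncomputable def vertexDegree {V : Type*} {m : ℕ} (ed : Fin m → Sym2 V) :
    (Fin m →₀ ℕ) →ₗ[ℕ] (V →₀ ℕ) :=
  Finsupp.linearCombination ℕ fun i => edgeExponent (ed i)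

section VertexDegree

variable {V : Type*} {m : ℕ} {ed : Fin m → Sym2 V}

@[simp]
theorem vertexDegree_single (i : Fin m) :
    vertexDegree ed (Finsupp.single i 1) = edgeExponent (ed i) := by
  simp [vertexDegree]

theorem vertexDegree_apply (u : Fin m →₀ ℕ) (x : V) :
    vertexDegree ed u x = ∑ i, u i * edgeExponent (ed i) x := by
  rw [vertexDegree, Finsupp.linearCombination_apply, Finsupp.sum_fintype _ _ (by simp),
    Finsupp.finsetSum_apply]
  rfl

theorem exists_edge_of_vertexDegree_ne_zero {u : Fin m →₀ ℕ} {x : V}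
    (h : vertexDegree ed u x ≠ 0) :
    ∃ i u' y, u = Finsupp.single i 1 + u' ∧ ed i = s(x, y) := by
  rw [vertexDegree_apply] at h
  obtain ⟨i, -, hi⟩ := exists_ne_zero_of_sum_ne_zero h
  obtain ⟨y, hy⟩ := mem_of_edgeExponent_ne_zero (right_ne_zero_of_mul hi)
  refine ⟨i, u - Finsupp.single i 1, y, (add_tsub_cancel_of_le ?_).symm, hy⟩
  exact Finsupp.single_le_iff.2 (Nat.one_le_iff_ne_zero.2 (left_ne_zero_of_mul hi))

theorem cast_edgeExponent {e : Sym2 V} {x y : V} (h : e = s(x, y)) (z : V) :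
    (edgeExponent e z : ℤ) = (vertexIndicator x + vertexIndicator y) z := by
  classical
  subst h
  simp [vertexIndicator, Finsupp.single_apply, Pi.single_apply, eq_comm]

theorem cast_vertexDegree_sum {S : Finset ℕ} {γ : ℕ → Fin m} {x y : ℕ → V}
    (h : ∀ k ∈ S, ed (γ k) = s(x k, y k)) (z : V) :
    (vertexDegree ed (∑ k ∈ S, Finsupp.single (γ k) 1) z : ℤ) =
      (∑ k ∈ S, (vertexIndicator (x k) + vertexIndicator (y k))) z := by
  rw [map_sum, Finsupp.finsetSum_apply, Nat.cast_sum, Finset.sum_apply]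
  refine sum_congr rfl fun k hk => ?_
  rw [vertexDegree_single, cast_edgeExponent (h k hk)]

theorem sum_single_update {n : ℕ} (γ : ℕ → Fin m) (i : Fin m) :
    ∑ k ∈ range (n + 1), Finsupp.single (Function.update γ n i k) (1 : ℕ) =
      ∑ k ∈ range n, Finsupp.single (γ k) 1 + Finsupp.single i 1 := by
  rw [sum_range_succ, Function.update_self]
  congr 1
  refine sum_congr rfl fun k hk => ?_
  rw [Function.update_of_ne (mem_range.1 hk).ne]

/-- An alternating walk starting with a given edge, either closed or of given length. -/
theorem exists_alternating_walk {u v : Fin m →₀ ℕ} (huv : vertexDegree ed u = vertexDegree ed v)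
    {M : Fin m} {a b : V} (hM : u M ≠ 0) (eM : ed M = s(a, b)) (n : ℕ) :
    (∃ (q : ℕ) (p r : ℕ → V) (α β : ℕ → Fin m) (u' v' : Fin m →₀ ℕ), 0 < q ∧ p q = p 0 ∧
      α 0 = M ∧ (∀ k < q, ed (α k) = s(p k, r k)) ∧ (∀ k < q, ed (β k) = s(r k, p (k + 1))) ∧
      u = ∑ k ∈ range q, Finsupp.single (α k) 1 + u' ∧
      v = ∑ k ∈ range q, Finsupp.single (β k) 1 + v' ∧
      vertexDegree ed u' = vertexDegree ed v') ∨
    ∃ (p r : ℕ → V) (α β : ℕ → Fin m) (u' v' : Fin m →₀ ℕ), α 0 = M ∧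
      (∀ k < n + 1, ed (α k) = s(p k, r k)) ∧ (∀ k < n, ed (β k) = s(r k, p (k + 1))) ∧
      u = ∑ k ∈ range (n + 1), Finsupp.single (α k) 1 + u' ∧
      v = ∑ k ∈ range n, Finsupp.single (β k) 1 + v' ∧
      vertexDegree ed v' = vertexDegree ed u' + Finsupp.single (p 0) 1 +
        Finsupp.single (r n) 1 := by
  induction n with
  | zero =>
    right
    have hu : u = Finsupp.single M 1 + (u - Finsupp.single M 1) :=
      (add_tsub_cancel_of_le (Finsupp.single_le_iff.2 (Nat.one_le_iff_ne_zero.2 hM))).symm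
    refine ⟨fun _ => a, fun _ => b, fun _ => M, fun _ => M, u - Finsupp.single M 1, v, rfl,
      fun k _ => eM, by simp, by simpa using hu, by simp, ?_⟩
    rw [← huv]
    conv_lhs => rw [hu]
    rw [map_add, vertexDegree_single, eM, edgeExponent_mk]
    abel
  | succ n ih =>
    rcases ih with ih | ⟨p, r, α, β, u', v', h0, hα, hβ, hu, hv, hD⟩
    · exact Or.inl ih
    -- The remainder `v'` exceeds `u'` in degree at the two ends of the walk, so an edge of `v'`
    -- leaves `r n`. If its other end `y` is not `p 0`, then `u'` in turn has an edge at `y`.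
    obtain ⟨i, v'', y, rfl, ei⟩ := exists_edge_of_vertexDegree_ne_zero (ed := ed) (u := v')
      (x := r n) (by rw [hD]; simp)
    rw [map_add, vertexDegree_single, ei, edgeExponent_mk] at hD
    have hD' : vertexDegree ed v'' + Finsupp.single y 1 =
        vertexDegree ed u' + Finsupp.single (p 0) 1 := by
      refine add_right_cancel (b := Finsupp.single (r n) 1) ?_
      rw [← hD]; abel
    have hp : ∀ k < n + 1, Function.update p (n + 1) y k = p k := fun k hk =>
      Function.update_of_ne hk.ne _ _
    have hβ' : ∀ k < n + 1, ed (Function.update β n i k) =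
        s(r k, Function.update p (n + 1) y (k + 1)) := fun k hk => by
      rcases Nat.lt_succ_iff_lt_or_eq.1 hk with hk' | rfl
      · rw [Function.update_of_ne hk'.ne, hβ k hk', hp _ (by omega)]
      · rw [Function.update_self, Function.update_self, ei]
    have hα' : ∀ k < n + 1, ed (α k) = s(Function.update p (n + 1) y k, r k) := fun k hk => by
      rw [hp k hk, hα k hk]
    have hv' : v = ∑ k ∈ range (n + 1), Finsupp.single (Function.update β n i k) 1 + v'' := by
      rw [hv, sum_single_update, add_assoc]
    by_cases hy : y = p 0
    · left
      refine ⟨n + 1, Function.update p (n + 1) y, r, α, Function.update β n i, u', v'',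
        n.succ_pos, ?_, h0, hα', hβ', hu, hv', ?_⟩
      · rw [Function.update_self, hp 0 n.succ_pos, hy]
      · rw [hy] at hD'
        exact (add_right_cancel hD').symm
    · right
      obtain ⟨j, u'', z, rfl, ej⟩ := exists_edge_of_vertexDegree_ne_zero (ed := ed) (u := u')
        (x := y) (by
          have := DFunLike.congr_fun hD' y
          simp only [Finsupp.add_apply, Finsupp.single_eq_same,
            Finsupp.single_eq_of_ne hy] at this
          omega)
      rw [map_add, vertexDegree_single, ej, edgeExponent_mk] at hD'
      refine ⟨Function.update p (n + 1) y, Function.update r (n + 1) z,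
        Function.update α (n + 1) j, Function.update β n i, u'', v'', ?_, ?_, ?_, ?_, hv', ?_⟩
      · rw [Function.update_of_ne n.succ_ne_zero.symm, h0]
      · intro k hk
        rcases Nat.lt_succ_iff_lt_or_eq.1 hk with hk' | rfl
        · rw [Function.update_of_ne hk'.ne, Function.update_of_ne hk'.ne (f := r), hα' k hk']
        · simp only [Function.update_self, ej]
      · intro k hk
        rw [Function.update_of_ne hk.ne (f := r), hβ' k hk]
      · rw [sum_single_update, hu, add_assoc]
      · rw [Function.update_self, hp 0 n.succ_pos]
        refine add_right_cancel (b := Finsupp.single y 1) ?_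
        rw [hD']; abel

theorem exists_closed_alternating_walk {u v : Fin m →₀ ℕ}
    (huv : vertexDegree ed u = vertexDegree ed v) {M : Fin m} (hM : u M ≠ 0) :
    ∃ (q : ℕ) (p r : ℕ → V) (α β : ℕ → Fin m) (u' v' : Fin m →₀ ℕ), 0 < q ∧ p q = p 0 ∧
      α 0 = M ∧ (∀ k < q, ed (α k) = s(p k, r k)) ∧ (∀ k < q, ed (β k) = s(r k, p (k + 1))) ∧
      u = ∑ k ∈ range q, Finsupp.single (α k) 1 + u' ∧
      v = ∑ k ∈ range q, Finsupp.single (β k) 1 + v' ∧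
      vertexDegree ed u' = vertexDegree ed v' := by
  obtain ⟨⟨a, b⟩, eM⟩ : ∃ x : V × V, ed M = s(x.1, x.2) :=
    ⟨Quot.out (ed M), (Quot.out_eq (ed M)).symm⟩
  -- An open walk of this length would use `u.degree + 1` edges of `u`.
  rcases exists_alternating_walk huv hM eM u.degree with h | ⟨p, r, α, β, u', v', -, -, -, hu, -⟩
  · exact h
  · have := congrArg Finsupp.degree hu
    simp at this
    omega

end VertexDegree

/-! ### Standard monomials and the tight walk of a minimal generator -/

open scoped MonomialOrder

/-- The exponents of the standard monomials of the toric ideal. -/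
def IsStandard {V : Type*} {m : ℕ} (ed : Fin m → Sym2 V) (u : Fin m →₀ ℕ) : Prop :=
  ∀ v, vertexDegree ed v = vertexDegree ed u → ¬ v ≺[lexAscending m] u

/-- The exponents of the minimal generators of the initial ideal of the toric ideal. -/
def IsMinimalNonstandard {V : Type*} {m : ℕ} (ed : Fin m → Sym2 V) (u : Fin m →₀ ℕ) : Prop :=
  ¬ IsStandard ed u ∧ ∀ u' ≤ u, u' ≠ u → IsStandard ed u'

section Standard

variable {V : Type*} {m : ℕ} {ed : Fin m → Sym2 V}

theorem IsStandard.of_le {u v : Fin m →₀ ℕ} (hv : IsStandard ed v) (h : u ≤ v) :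
    IsStandard ed u := by
  intro w hw hlt
  obtain ⟨t, rfl⟩ := exists_add_of_le h
  refine hv (w + t) (by rw [map_add, map_add, hw]) ?_
  rw [map_add, map_add]
  exact add_lt_add_left hlt _

theorem IsStandard.unique {u v : Fin m →₀ ℕ} (hu : IsStandard ed u) (hv : IsStandard ed v)
    (h : vertexDegree ed u = vertexDegree ed v) : u = v := by
  rcases lt_trichotomy ((lexAscending m).toSyn u) ((lexAscending m).toSyn v) with h' | h' | h'
  · exact (hv u h h').elim
  · exact (lexAscending m).toSyn.injective h'
  · exact (hu v h.symm h').elim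

theorem exists_isStandard (ed : Fin m → Sym2 V) (u : Fin m →₀ ℕ) :
    ∃ v, vertexDegree ed v = vertexDegree ed u ∧ IsStandard ed v := by
  have hwf : WellFounded fun v w : Fin m →₀ ℕ => v ≺[lexAscending m] w :=
    InvImage.wf (lexAscending m).toSyn (wellFounded_lt (α := (lexAscending m).syn))
  obtain ⟨v, hv, hmin⟩ := hwf.has_min {v | vertexDegree ed v = vertexDegree ed u} ⟨u, rfl⟩
  exact ⟨v, hv, fun w hw => hmin w (hw.trans hv)⟩

/-- After cancelling a common variable both exponents are standard in the same fibre, hence equal,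
which would make `u = v` standard. -/
theorem IsMinimalNonstandard.coprime {u v : Fin m →₀ ℕ} (hu : IsMinimalNonstandard ed u)
    (hv : IsStandard ed v) (h : vertexDegree ed u = vertexDegree ed v) (i : Fin m) :
    u i = 0 ∨ v i = 0 := by
  by_contra! hi
  have hu' : u - Finsupp.single i 1 + Finsupp.single i 1 = u :=
    tsub_add_cancel_of_le (Finsupp.single_le_iff.2 (Nat.one_le_iff_ne_zero.2 hi.1))
  have hv' : v - Finsupp.single i 1 + Finsupp.single i 1 = v :=
    tsub_add_cancel_of_le (Finsupp.single_le_iff.2 (Nat.one_le_iff_ne_zero.2 hi.2))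
  have hne : u - Finsupp.single i 1 ≠ u := fun e => by
    rw [e] at hu'
    simp at hu'
  refine hu.1 ?_
  suffices u = v by rwa [this]
  rw [← hu', ← hv', (hu.2 _ tsub_le_self hne).unique (hv.of_le tsub_le_self) ?_]
  rw [← hu', ← hv', map_add, map_add] at h
  exact add_right_cancel h

theorem IsMinimalNonstandard.exists_max {u v : Fin m →₀ ℕ} (hu : IsMinimalNonstandard ed u)
    (hv : IsStandard ed v) (h : vertexDegree ed u = vertexDegree ed v) :
    ∃ M, u M ≠ 0 ∧ v M = 0 ∧ ∀ j, M < j → u j = 0 ∧ v j = 0 := by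
  have hlt : v ≺[lexAscending m] u := by
    rcases lt_trichotomy ((lexAscending m).toSyn u) ((lexAscending m).toSyn v) with h' | h' | h'
    · exact (hv u h h').elim
    · rw [(lexAscending m).toSyn.injective h'] at hu
      exact (hu.1 hv).elim
    · exact h'
  obtain ⟨M, hM, hlt⟩ := (lexAscending_lt_iff _ _).1 hlt
  have := hu.coprime hv h
  refine ⟨M, by omega, by have := this M; omega, fun j hj => ?_⟩
  have h1 := hM j hj
  have h2 := this j
  omega

theorem sum_single_ne_zero {S : Finset ℕ} {γ : ℕ → Fin m} {k : ℕ} (hk : k ∈ S) :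
    (∑ k ∈ S, Finsupp.single (γ k) 1 : Fin m →₀ ℕ) (γ k) ≠ 0 := by
  have : (Finsupp.single (γ k) 1 : Fin m →₀ ℕ) ≤ ∑ k ∈ S, Finsupp.single (γ k) 1 :=
    single_le_sum (f := fun k => (Finsupp.single (γ k) 1 : Fin m →₀ ℕ))
      (fun _ _ => bot_le) hk
  have := this (γ k)
  rw [Finsupp.single_eq_same] at this
  omega

theorem sum_single_le {S T : Finset ℕ} (γ : ℕ → Fin m) (h : S ⊆ T) :
    (∑ k ∈ S, Finsupp.single (γ k) 1 : Fin m →₀ ℕ) ≤ ∑ k ∈ T, Finsupp.single (γ k) 1 :=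
  sum_le_sum_of_subset h

theorem eq_range_of_sum_single_eq {S : Finset ℕ} {q : ℕ} {γ : ℕ → Fin m} (h : S ⊆ range q)
    (e : (∑ k ∈ S, Finsupp.single (γ k) 1 : Fin m →₀ ℕ) = ∑ k ∈ range q, Finsupp.single (γ k) 1) :
    S = range q := by
  refine eq_of_subset_of_card_le h ?_
  have := congrArg Finsupp.degree e
  simp only [map_sum, Finsupp.degree_single, sum_const, smul_eq_mul, mul_one] at this
  exact this.ge

theorem IsMinimalNonstandard.exists_isTightWalk {u v : Fin m →₀ ℕ}
    (hu : IsMinimalNonstandard ed u) (hv : IsStandard ed v)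
    (h : vertexDegree ed u = vertexDegree ed v) :
    ∃ (q : ℕ) (p r : ℕ → V) (α β : ℕ → Fin m), IsTightWalk ed q p r α β ∧
      u = ∑ k ∈ range q, Finsupp.single (α k) 1 ∧ v = ∑ k ∈ range q, Finsupp.single (β k) 1 := by
  obtain ⟨M, huM, hvM, hmax⟩ := hu.exists_max hv h
  obtain ⟨q, p, r, α, β, u', v', hq, hclosed, h0, hα, hβ, hu', hv', h'⟩ :=
    exists_closed_alternating_walk h huM
  have hcop := hu.coprime hv h
  -- A proper divisor of `u` and a divisor of `v` are both standard; in one fibre they coincide, and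
  -- coprimality makes them trivial.
  have hprim : ∀ u₁ ≤ u, ∀ v₁ ≤ v, u₁ ≠ 0 → vertexDegree ed u₁ = vertexDegree ed v₁ →
      u₁ = u ∧ v₁ = v := by
    intro u₁ hu₁ v₁ hv₁ h0 h₁
    by_cases hne : u₁ = u
    · subst hne
      exact ⟨rfl, (hv.of_le hv₁).unique hv (h₁.symm.trans h)⟩
    · exfalso
      have := (hu.2 u₁ hu₁ hne).unique (hv.of_le hv₁) h₁
      subst this
      refine h0 (Finsupp.ext fun i => ?_)
      have h1 := hu₁ i
      have h2 := hv₁ i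
      have h3 := hcop i
      rw [Finsupp.zero_apply]
      omega
  have hall := hprim (∑ k ∈ range q, Finsupp.single (α k) 1) (hu' ▸ le_self_add)
    (∑ k ∈ range q, Finsupp.single (β k) 1) (hv' ▸ le_self_add)
    (fun e => sum_single_ne_zero (γ := α) (mem_range.2 hq) (by rw [e]; rfl)) (by
      rw [hu', hv', map_add, map_add, h'] at h
      exact add_right_cancel h)
  obtain ⟨hU, hV⟩ := hall
  have huα : ∀ k < q, u (α k) ≠ 0 := fun k hk => by
    rw [← hU]; exact sum_single_ne_zero (mem_range.2 hk)
  have hvβ : ∀ k < q, v (β k) ≠ 0 := fun k hk => by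
    rw [← hV]; exact sum_single_ne_zero (mem_range.2 hk)
  refine ⟨q, p, r, α, β, ?_, hU.symm, hV.symm⟩
  constructor
  · exact hq
  · exact hclosed
  · exact hα
  · exact hβ
  · intro k hk
    rw [h0]
    by_contra hlt
    exact huα k hk (hmax _ (not_le.1 hlt)).1
  · intro k hk
    rw [h0]
    by_contra hlt
    rcases (not_lt.1 hlt).eq_or_lt with e | hlt
    · exact hvβ k hk (e ▸ hvM)
    · exact hvβ k hk (hmax _ hlt).2
  · intro S T hS hT ⟨c, hc⟩ e
    have hD : vertexDegree ed (∑ k ∈ S, Finsupp.single (α k) 1) =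
        vertexDegree ed (∑ k ∈ T, Finsupp.single (β k) 1) := Finsupp.ext fun z => by
      have := congrFun e z
      rw [← cast_vertexDegree_sum (fun k hk => hα k (mem_range.1 (hS hk))),
        ← cast_vertexDegree_sum (fun k hk => hβ k (mem_range.1 (hT hk)))] at this
      exact_mod_cast this
    refine eq_range_of_sum_single_eq hS (((hprim _ ?_ _ ?_ ?_ hD).1).trans hU.symm)
    · rw [← hU]; exact sum_single_le α hS
    · rw [← hV]; exact sum_single_le β hT
    · exact fun e => sum_single_ne_zero (γ := α) hc (by rw [e]; rfl)
  · intro S T hS hT hc i hi x y exy e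
    have hD : vertexDegree ed (∑ k ∈ T, Finsupp.single (β k) 1 + Finsupp.single i 1) =
        vertexDegree ed (∑ k ∈ S, Finsupp.single (α k) 1) := Finsupp.ext fun z => by
      have := congrFun e z
      rw [← cast_vertexDegree_sum (fun k hk => hα k (mem_range.1 (hS hk))), Pi.add_apply,
        ← cast_vertexDegree_sum (fun k hk => hβ k (mem_range.1 (hT hk))),
        ← cast_edgeExponent exy] at this
      rw [map_add, vertexDegree_single, Finsupp.add_apply]
      exact_mod_cast this.symm
    have hSu : ∑ k ∈ S, Finsupp.single (α k) 1 ≤ u := by rw [← hU]; exact sum_single_le α hS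
    have hTv : ∑ k ∈ T, Finsupp.single (β k) 1 ≤ v := by rw [← hV]; exact sum_single_le β hT
    refine eq_range_of_sum_single_eq hS (Eq.trans ?_ hU.symm)
    by_contra hne
    -- The part `S` involves `y_M`, while `T` and the extra edge involve only smaller variables. So
    -- a proper `S` would be a nonstandard proper divisor of `u`.
    refine hu.2 _ hSu hne _ hD ((lexAscending_lt_iff _ _).2 ⟨M, fun j hj => ?_, ?_⟩)
    · have h1 := hSu j
      have h2 := hTv j
      obtain ⟨h3, h4⟩ := hmax j hj
      rw [h0] at hi
      rw [Finsupp.add_apply, Finsupp.single_eq_of_ne (hi.trans hj).ne']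
      omega
    · have h2 := hTv M
      have h1 := sum_single_ne_zero (γ := α) hc
      rw [h0] at h1 hi
      rw [Finsupp.add_apply, Finsupp.single_eq_of_ne hi.ne']
      omega

theorem sum_single_le_one {q : ℕ} {γ : ℕ → Fin m} (h : ∀ i < q, ∀ j < q, γ i = γ j → i = j)
    (i : Fin m) : (∑ k ∈ range q, Finsupp.single (γ k) 1 : Fin m →₀ ℕ) i ≤ 1 := by
  simp only [Finsupp.finsetSum_apply, Finsupp.single_apply, ← card_filter]
  refine card_le_one.2 fun a ha b hb => ?_
  simp only [mem_filter, mem_range] at ha hb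
  exact h a ha.1 b hb.1 (ha.2.trans hb.2.symm)

theorem sum_single_ne_zero_iff {q : ℕ} {γ : ℕ → Fin m} {i : Fin m} :
    (∑ k ∈ range q, Finsupp.single (γ k) 1 : Fin m →₀ ℕ) i ≠ 0 ↔ ∃ k < q, γ k = i := by
  constructor
  · intro h
    rw [Finsupp.finsetSum_apply] at h
    obtain ⟨k, hk, h⟩ := exists_ne_zero_of_sum_ne_zero h
    exact ⟨k, mem_range.1 hk, by by_contra hne; exact h (Finsupp.single_eq_of_ne' hne)⟩
  · rintro ⟨k, hk, rfl⟩
    exact sum_single_ne_zero (mem_range.2 hk)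

/-- Every integral relation between the edges of a tight walk is a multiple of the alternating
one. -/
theorem IsTightWalk.coeff_eq {q : ℕ} {p r : ℕ → V} {α β : ℕ → Fin m}
    (W : IsTightWalk ed q p r α β) (hd : ∀ i, ¬ (ed i).IsDiag) (H : HasJoiningEdges ed)
    (hαβ : ∀ i < q, ∀ j < q, α i ≠ β j) {c : Fin m → ℤ}
    (hc : ∀ i, c i ≠ 0 → ∃ k < q, α k = i ∨ β k = i)
    (h : ∀ x, ∑ i, c i * (edgeExponent (ed i) x : ℤ) = 0) :
    ∀ k < q, c (α k) = c (α 0) ∧ c (β k) = - c (α 0) := by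
  classical
  -- Extending the coefficients by `A q = A 0` matches `p q = p 0` and avoids indices modulo `q`.
  set A : ℕ → ℤ := fun k => if k = q then c (α 0) else c (α k) with hA
  have hA' : ∀ k < q, A k = c (α k) := fun k hk => if_neg hk.ne
  have hA0 : A 0 = c (α 0) := hA' 0 W.pos
  have hAq : A q = c (α 0) := if_pos rfl
  have hsum : ∀ x, ∑ k ∈ range q, (A (k + 1) + c (β k)) * vertexIndicator (p (k + 1)) x +
      ∑ k ∈ range q, (A k + c (β k)) * vertexIndicator (r k) x = 0 := by
    intro x
    have hsplit : ∑ i, c i * (edgeExponent (ed i) x : ℤ) =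
        ∑ k ∈ range q, c (α k) * (edgeExponent (ed (α k)) x : ℤ) +
        ∑ k ∈ range q, c (β k) * (edgeExponent (ed (β k)) x : ℤ) := by
      rw [← sum_image (s := range q) (g := α) (f := fun i => c i * (edgeExponent (ed i) x : ℤ))
          (fun i hi j hj => W.left_injOn hd H (mem_range.1 hi) (mem_range.1 hj)),
        ← sum_image (s := range q) (g := β) (f := fun i => c i * (edgeExponent (ed i) x : ℤ))
          (fun i hi j hj => W.right_injOn hd H (mem_range.1 hi) (mem_range.1 hj)),
        ← sum_union]
      · symm
        refine sum_subset (subset_univ _) fun i _ hi => ?_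
        have : c i = 0 := by
          by_contra hne
          obtain ⟨k, hk, e⟩ := hc i hne
          refine hi (mem_union.2 ?_)
          rcases e with e | e
          · exact Or.inl (mem_image.2 ⟨k, mem_range.2 hk, e⟩)
          · exact Or.inr (mem_image.2 ⟨k, mem_range.2 hk, e⟩)
        rw [this, zero_mul]
      · refine disjoint_left.2 fun i hi hj => ?_
        obtain ⟨k, hk, rfl⟩ := mem_image.1 hi
        obtain ⟨l, hl, e⟩ := mem_image.1 hj
        exact hαβ k (mem_range.1 hk) l (mem_range.1 hl) e.symm
    have hα : ∑ k ∈ range q, c (α k) * (edgeExponent (ed (α k)) x : ℤ) =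
        ∑ k ∈ range q, A k * vertexIndicator (p k) x +
          ∑ k ∈ range q, A k * vertexIndicator (r k) x := by
      rw [← sum_add_distrib]
      refine sum_congr rfl fun k hk => ?_
      rw [hA' k (mem_range.1 hk), cast_edgeExponent (W.edge_left k (mem_range.1 hk)),
        Pi.add_apply, mul_add]
    have hβ : ∑ k ∈ range q, c (β k) * (edgeExponent (ed (β k)) x : ℤ) =
        ∑ k ∈ range q, c (β k) * vertexIndicator (r k) x +
          ∑ k ∈ range q, c (β k) * vertexIndicator (p (k + 1)) x := by
      rw [← sum_add_distrib]
      refine sum_congr rfl fun k hk => ?_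
      rw [cast_edgeExponent (W.edge_right k (mem_range.1 hk)), Pi.add_apply, mul_add]
    have hshift : ∑ k ∈ range q, A k * vertexIndicator (p k) x =
        ∑ k ∈ range q, A (k + 1) * vertexIndicator (p (k + 1)) x := by
      refine add_right_cancel (b := A 0 * vertexIndicator (p 0) x) ?_
      rw [← sum_range_succ' (fun k => A k * vertexIndicator (p k) x), sum_range_succ, hA0, hAq,
        W.closed]
    have := h x
    rw [hsplit, hα, hβ, hshift] at this
    simp only [add_mul, sum_add_distrib]
    linarith
  have hshift : ∀ i < q, ∃ k < q, p k = p (i + 1) ∧ (k = i + 1 ∨ k = 0 ∧ i + 1 = q) :=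
    fun i hi => W.exists_even_eq hi
  -- The relation is grouped by vertices; the two coefficient sums differ by a cyclic shift of `A`.
  -- Vanishing gives `A (k + 1) = -c (β k) = A k`.
  have hzero := coeff_eq_zero_of_sum_eq_zero (P := fun k => p (k + 1)) (R := r)
    (fun i hi j hj e => by
      obtain ⟨i', hi', hpi, hi''⟩ := hshift i hi
      obtain ⟨j', hj', hpj, hj''⟩ := hshift j hj
      have := W.even_inj hi' hj' (hpi.trans (e.trans hpj.symm))
      omega)
    (fun i hi j hj => W.odd_inj hi hj)
    (fun i hi j hj k hk l hl e e' => by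
      obtain ⟨i', hi', hpi, hi''⟩ := hshift i hi
      obtain ⟨k', hk', hpk, hk''⟩ := hshift k hk
      have := W.even_index_unique hd H hi' hj hk' hl (hpi.trans e) (hpk.trans e')
      omega)
    (by
      rw [sum_add_distrib, sum_add_distrib]
      congr 1
      refine add_right_cancel (b := A 0) ?_
      rw [← sum_range_succ', sum_range_succ, hA0, hAq])
    hsum
  have hAk : ∀ k < q, A k = c (α 0) := by
    intro k
    induction k with
    | zero => exact fun _ => hA0
    | succ k ih =>
      intro hk
      have := hzero k (by omega)
      have := ih (by omega)
      omega
  intro k hk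
  have h1 := hAk k hk
  have h2 := (hzero k hk).2
  have h3 := hA' k hk
  constructor <;> omega

end Standard

end EdgeToric

/-! ### Initial ideals and uniqueness of reduced Gröbner bases -/

namespace EdgeToric

open MvPolynomial
open scoped MonomialOrder

section ReducedGroebnerBasis

variable {K σ : Type*} [Field K] {τ : MonomialOrder σ} {I : Ideal (MvPolynomial σ K)}

theorem initialIdeal_eq_span (τ : MonomialOrder σ) (I : Ideal (MvPolynomial σ K)) :
    initialIdeal τ I =
      Ideal.span ((fun s => monomial s (1 : K)) '' {d | ∃ f ∈ I, f ≠ 0 ∧ τ.degree f = d}) := by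
  apply le_antisymm
  · refine Ideal.span_le.2 ?_
    rintro _ ⟨f, hf, rfl⟩
    by_cases h0 : f = 0
    · simp [h0]
    · rw [← τ.C_mul_leadingCoeff_monomial_degree]
      exact Ideal.mul_mem_left _ _ (Ideal.subset_span ⟨_, ⟨f, hf, h0, rfl⟩, rfl⟩)
  · refine Ideal.span_le.2 ?_
    rintro _ ⟨_, ⟨f, hf, h0, rfl⟩, rfl⟩
    have hc : τ.leadingCoeff f ≠ 0 := τ.leadingCoeff_ne_zero_iff.2 h0
    have : monomial (τ.degree f) (1 : K) = C (τ.leadingCoeff f)⁻¹ * τ.leadingTerm f := by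
      rw [MonomialOrder.leadingTerm, C_mul_monomial, inv_mul_cancel₀ hc]
    change monomial (τ.degree f) (1 : K) ∈ initialIdeal τ I
    rw [this]
    exact Ideal.mul_mem_left _ _ (Ideal.subset_span ⟨f, hf, rfl⟩)

theorem monomial_mem_span_iff {s : Set (σ →₀ ℕ)} {u : σ →₀ ℕ} :
    monomial u (1 : K) ∈ Ideal.span ((fun s => monomial s (1 : K)) '' s) ↔ ∃ v ∈ s, v ≤ u := by
  classical
  rw [mem_ideal_span_monomial_image, support_monomial, if_neg one_ne_zero]
  simp

theorem monomial_mem_initialIdeal_iff {u : σ →₀ ℕ} :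
    monomial u (1 : K) ∈ initialIdeal τ I ↔ ∃ f ∈ I, f ≠ 0 ∧ τ.degree f ≤ u := by
  rw [initialIdeal_eq_span, monomial_mem_span_iff]
  constructor
  · rintro ⟨_, ⟨f, hf, h0, rfl⟩, h⟩
    exact ⟨f, hf, h0, h⟩
  · rintro ⟨f, hf, h0, h⟩
    exact ⟨_, ⟨f, hf, h0, rfl⟩, h⟩

theorem leadingTerm_of_monic {b : MvPolynomial σ K} (h : τ.Monic b) :
    τ.leadingTerm b = monomial (τ.degree b) 1 := by
  rw [MonomialOrder.leadingTerm, h.leadingCoeff_eq_one]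

theorem image_leadingTerm_of_monic {B : Set (MvPolynomial σ K)} (h : ∀ b ∈ B, τ.Monic b) :
    τ.leadingTerm '' B = (fun s => monomial s (1 : K)) '' (τ.degree '' B) := by
  rw [Set.image_image]
  exact Set.image_congr fun b hb => leadingTerm_of_monic (h b hb)

namespace IsReducedGroebnerBasis

variable {B B' : Set (MvPolynomial σ K)}

theorem exists_degree_le (hB : IsReducedGroebnerBasis τ I B) {f : MvPolynomial σ K} (hf : f ∈ I)
    (h0 : f ≠ 0) : ∃ b ∈ B, τ.degree b ≤ τ.degree f := by
  have h : monomial (τ.degree f) (1 : K) ∈ initialIdeal τ I :=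
    monomial_mem_initialIdeal_iff.2 ⟨f, hf, h0, le_rfl⟩
  rw [← hB.span_leadingTerm, image_leadingTerm_of_monic hB.monic, monomial_mem_span_iff] at h
  obtain ⟨_, ⟨b, hb, rfl⟩, h⟩ := h
  exact ⟨b, hb, h⟩

theorem eq_of_degree_le (hB : IsReducedGroebnerBasis τ I B) {b c : MvPolynomial σ K} (hb : b ∈ B)
    (hc : c ∈ B) (h : τ.degree c ≤ τ.degree b) : c = b := by
  by_contra hne
  refine hB.minimal b hb ?_
  rw [leadingTerm_of_monic (hB.monic b hb),
    image_leadingTerm_of_monic fun x hx => hB.monic x hx.1, monomial_mem_span_iff]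
  exact ⟨_, ⟨c, ⟨hc, hne⟩, rfl⟩, h⟩

/-- Elements of the two bases with the same leading monomial coincide: the leading monomial of a
nonzero difference would lie in the initial ideal and be a trailing monomial of one of them. -/
theorem subset_of (hB : IsReducedGroebnerBasis τ I B) (hB' : IsReducedGroebnerBasis τ I B') :
    B ⊆ B' := by
  intro b hb
  obtain ⟨b', hb', h'⟩ := hB'.exists_degree_le (hB.subset hb) (hB.monic b hb).ne_zero
  obtain ⟨c, hc, h⟩ := hB.exists_degree_le (hB'.subset hb') (hB'.monic b' hb').ne_zero
  obtain rfl := hB.eq_of_degree_le hb hc (h.trans h')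
  have hdeg : τ.degree c = τ.degree b' := le_antisymm h h'
  suffices c = b' by rwa [this]
  by_contra hne
  have hmem : monomial (τ.degree (c - b')) (1 : K) ∈ initialIdeal τ I :=
    monomial_mem_initialIdeal_iff.2
      ⟨_, I.sub_mem (hB.subset hb) (hB'.subset hb'), sub_ne_zero.2 hne, le_rfl⟩
  have hsupp := τ.degree_mem_support (sub_ne_zero.2 hne)
  have hdeg' : τ.degree (c - b') ≠ τ.degree c := by
    intro e
    rw [e, mem_support_iff, coeff_sub, (hB.monic c hb).coeff_degree, hdeg,
      (hB'.monic b' hb').coeff_degree, sub_self] at hsupp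
    exact hsupp rfl
  by_cases hc0 : τ.degree (c - b') ∈ c.support
  · exact hB.trailing c hb _ hc0 hdeg' hmem
  · refine hB'.trailing b' hb' _ ?_ (hdeg ▸ hdeg') hmem
    rw [notMem_support_iff] at hc0
    rw [mem_support_iff, coeff_sub, hc0, zero_sub, neg_ne_zero] at hsupp
    exact mem_support_iff.2 hsupp

/-- The reduced Gröbner basis is unique. -/
theorem unique (hB : IsReducedGroebnerBasis τ I B) (hB' : IsReducedGroebnerBasis τ I B') :
    B = B' :=
  (hB.subset_of hB').antisymm (hB'.subset_of hB)

end IsReducedGroebnerBasis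

end ReducedGroebnerBasis

/-! ### Binomials: support, degree, irreducibility -/

section Binomial

variable {K σ : Type*} [Field K] {u v : σ →₀ ℕ}

theorem mem_support_binomial (h : u ≠ v) {w : σ →₀ ℕ} :
    w ∈ (monomial u (1 : K) - monomial v 1).support ↔ w = u ∨ w = v := by
  classical
  simp only [mem_support_iff, coeff_sub, coeff_monomial]
  by_cases h1 : u = w
  · subst h1
    simp [h.symm]
  · by_cases h2 : v = w
    · simp [h1, h2]
    · simp [h1, h2, Ne.symm h1, Ne.symm h2]

theorem mem_vars_binomial (h : u ≠ v) {i : σ} :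
    i ∈ (monomial u (1 : K) - monomial v 1).vars ↔ u i ≠ 0 ∨ v i ≠ 0 := by
  simp [mem_vars_iff_mem_support, mem_support_binomial h]

theorem degree_binomial {τ : MonomialOrder σ} (h : v ≺[τ] u) :
    τ.degree (monomial u (1 : K) - monomial v 1) = u := by
  classical
  rw [MonomialOrder.degree_sub_of_lt] <;>
  simp [MonomialOrder.degree_monomial, h]

theorem monic_binomial {τ : MonomialOrder σ} (h : v ≺[τ] u) :
    τ.Monic (monomial u (1 : K) - monomial v 1) := by
  classical
  rw [MonomialOrder.Monic, MonomialOrder.leadingCoeff, degree_binomial h, coeff_sub,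
    coeff_monomial, coeff_monomial, if_pos rfl, if_neg, sub_zero]
  rintro rfl
  exact lt_irrefl _ h

/-- A pure difference of coprime squarefree monomials is irreducible. -/
theorem irreducible_binomial {i : σ} (hi : u i = 1) (huv : ∀ j, u j = 0 ∨ v j = 0) :
    Irreducible (monomial u (1 : K) - monomial v 1) := by
  classical
  have hne : u ≠ v := by
    rintro rfl
    have := huv i
    omega
  have hdisj : Disjoint u.support v.support := Finset.disjoint_left.2 fun j h1 h2 => by
    have := huv j
    rw [Finsupp.mem_support_iff] at h1 h2
    tauto
  have hsupp := fun w => mem_support_binomial (K := K) hne (w := w)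
  refine irreducible_of_disjoint_support (d := u) (i := i)
    ⟨u, (hsupp u).2 (Or.inl rfl), v, (hsupp v).2 (Or.inr rfl), hne⟩
    ((hsupp u).2 (Or.inl rfl)) hi ?_ ?_
  · intro a ha b hb hab
    rw [Finset.mem_coe, hsupp] at ha hb
    rcases ha with rfl | rfl <;> rcases hb with rfl | rfl
    · exact (hab rfl).elim
    · exact hdisj
    · exact hdisj.symm
    · exact (hab rfl).elim
  · intro r hr
    have := hr u
    rw [coeff_sub, coeff_monomial, coeff_monomial, if_pos rfl, if_neg hne.symm, sub_zero] at this
    exact isUnit_of_dvd_one this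

end Binomial

/-! ### From linear quotients to joining edges -/

section LinearQuotients

variable {K V : Type*} [Field K]

theorem edgeMonomial_eq_monomial (e : Sym2 V) : edgeMonomial K e = monomial (edgeExponent e) 1 := by
  induction e with
  | h a b => simp [edgeMonomial, X, monomial_mul]

theorem edgeExponent_ne_zero_of_mem {e : Sym2 V} {x : V} (h : x ∈ e) : edgeExponent e x ≠ 0 := by
  obtain ⟨y, rfl⟩ := h
  simp

theorem exists_eq_of_edgeExponent_le {e e' : Sym2 V} (hd : ¬ e.IsDiag) (hne : e ≠ e') {z : V}
    (h : edgeExponent e ≤ Finsupp.single z 1 + edgeExponent e') :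
    ∃ b ∈ e', e = s(z, b) := by
  have hmem : ∀ x ∈ e, x = z ∨ x ∈ e' := by
    intro x hx
    by_contra! hxz
    have h1 := edgeExponent_ne_zero_of_mem hx
    have h2 := h x
    have h3 : edgeExponent e' x = 0 := by
      by_contra h3
      exact hxz.2 (mem_of_edgeExponent_ne_zero h3)
    rw [Finsupp.add_apply, Finsupp.single_eq_of_ne hxz.1, h3] at h2
    omega
  induction e with
  | h x y =>
    rw [Sym2.mk_isDiag_iff] at hd
    rcases hmem x (Sym2.mem_mk_left x y) with rfl | hx
    · rcases hmem y (Sym2.mem_mk_right x y) with rfl | hy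
      · exact (hd rfl).elim
      · exact ⟨y, hy, rfl⟩
    · rcases hmem y (Sym2.mem_mk_right x y) with rfl | hy
      · exact ⟨x, hx, Sym2.eq_swap⟩
      · exact (hne ((Sym2.mem_and_mem_iff hd).1 ⟨hx, hy⟩).symm).elim

/-- A linear quotient ordering of the edges has the joining property. -/
theorem IsLinearQuotientOrdering.hasJoiningEdges {m : ℕ} {ed : Fin m → Sym2 V}
    (hinj : Function.Injective ed) (hd : ∀ i, ¬ (ed i).IsDiag) {I : Ideal (MvPolynomial V K)}
    (h : IsLinearQuotientOrdering I fun i => edgeMonomial K (ed i)) : HasJoiningEdges ed := by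
  intro j i hji _
  obtain ⟨L, hL, hcolon⟩ := h.2.2 i (by have := Fin.lt_def.1 hji; omega)
  set Z : Set V := {z | ∃ k < i, ∃ b ∈ ed i, ed k = s(z, b)} with hZ
  have himage : (fun i => edgeMonomial K (ed i)) '' {k | k < i} =
      (fun s => monomial s (1 : K)) '' ((fun k => edgeExponent (ed k)) '' {k | k < i}) := by
    rw [Set.image_image]
    exact Set.image_congr fun k _ => edgeMonomial_eq_monomial _
  -- The earlier edges span a monomial ideal, so for each variable `z` in a linear form of the colon
  -- ideal some earlier edge monomial divides `x_z` times that of `ed i`; that edge joins `z` to `ed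
  -- i`.
  have hLZ : Ideal.span L ≤ Ideal.span (X '' Z) := by
    refine Ideal.span_le.2 fun l hl => mem_ideal_span_X_image.2 fun w hw => ?_
    have hlc : l ∈ (Ideal.span ((fun i => edgeMonomial K (ed i)) '' {k | k < i})).colon
        {edgeMonomial K (ed i)} := hcolon ▸ Ideal.subset_span hl
    rw [Submodule.mem_colon_singleton, smul_eq_mul, himage, edgeMonomial_eq_monomial,
      mem_ideal_span_monomial_image] at hlc
    obtain ⟨z, rfl⟩ : ∃ z, w = Finsupp.single z 1 := by
      have := hL l hl (mem_support_iff.1 hw)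
      have h1 : w.degree = 1 := by
        rw [Finsupp.degree_eq_weight_one]
        exact this
      exact (Finsupp.sum_eq_one_iff _).1 h1
    obtain ⟨_, ⟨k, hk, rfl⟩, hle⟩ := hlc (Finsupp.single z 1 + edgeExponent (ed i)) (by
      rw [mem_support_iff, coeff_mul_monomial, mul_one]
      exact mem_support_iff.1 hw)
    obtain ⟨b, hb, e⟩ := exists_eq_of_edgeExponent_le (hd k) (fun e => hk.ne (hinj e)) hle
    exact ⟨z, ⟨k, hk, b, hb, e⟩, by simp⟩
  have hj : edgeMonomial K (ed j) ∈ Ideal.span (X '' Z) := by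
    refine hLZ (hcolon ▸ ?_)
    rw [Submodule.mem_colon_singleton, smul_eq_mul]
    exact Ideal.mul_mem_right _ _ (Ideal.subset_span ⟨j, hji, rfl⟩)
  rw [edgeMonomial_eq_monomial, mem_ideal_span_X_image] at hj
  obtain ⟨z, ⟨k, hk, b, hb, e⟩, hz⟩ := hj (edgeExponent (ed j)) (by
    classical
    simp [support_monomial])
  exact ⟨k, hk, z, b, mem_of_edgeExponent_ne_zero hz, hb, e⟩

end LinearQuotients

/-! ### The reduced Gröbner basis of the toric ideal and its circuits -/

section ToricIdeal

variable {K V : Type*} [Field K] {G : SimpleGraph V} {m : ℕ} (e : Fin m ≃ G.edgeSet)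

theorem aeval_edgeMonomial_monomial (ed : Fin m → Sym2 V) (u : Fin m →₀ ℕ) (c : K) :
    aeval (fun i => edgeMonomial K (ed i)) (monomial u c) = monomial (vertexDegree ed u) c := by
  rw [aeval_monomial, algebraMap_eq, vertexDegree, Finsupp.linearCombination_apply, Finsupp.sum,
    Finsupp.prod]
  have : monomial (∑ i ∈ u.support, u i • edgeExponent (ed i)) c =
      C c * monomial (∑ i ∈ u.support, u i • edgeExponent (ed i)) 1 := by
    rw [C_mul_monomial, mul_one]
  rw [this, monomial_sum_one]
  congr 1
  refine Finset.prod_congr rfl fun i _ => ?_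
  rw [edgeMonomial_eq_monomial, monomial_pow, one_pow]

theorem binomial_mem_toricIdeal_iff {u v : Fin m →₀ ℕ} :
    monomial u (1 : K) - monomial v 1 ∈ toricIdeal K e ↔
      vertexDegree (fun i => (e i : Sym2 V)) u = vertexDegree (fun i => (e i : Sym2 V)) v := by
  rw [toricIdeal, RingHom.mem_ker, map_sub, sub_eq_zero, aeval_edgeMonomial_monomial,
    aeval_edgeMonomial_monomial]
  exact (monomial_left_injective one_ne_zero).eq_iff

variable {e}

/-- Any other term of `f` with the same image monomial would be a smaller element of the fibre. If
the leading exponent were standard there would be none, so the leading term could not cancel in the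
image. -/
theorem not_isStandard_degree {f : MvPolynomial (Fin m) K} (hf : f ∈ toricIdeal K e)
    (h0 : f ≠ 0) :
    ¬ IsStandard (fun i => (e i : Sym2 V)) ((lexAscending m).degree f) := by
  classical
  intro hstd
  set ed : Fin m → Sym2 V := fun i => (e i : Sym2 V) with hed
  set d := (lexAscending m).degree f with hd
  rw [toricIdeal, RingHom.mem_ker, f.as_sum, map_sum] at hf
  have hcoeff := congrArg (coeff (vertexDegree ed d)) hf
  rw [coeff_sum, coeff_zero, Finset.sum_eq_single_of_mem d
    ((lexAscending m).degree_mem_support h0)] at hcoeff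
  · rw [aeval_edgeMonomial_monomial ed, coeff_monomial, if_pos rfl] at hcoeff
    exact (lexAscending m).coeff_degree_ne_zero_iff.2 h0 hcoeff
  · intro w hw hwd
    rw [aeval_edgeMonomial_monomial ed, coeff_monomial, if_neg]
    intro hwe
    refine hstd w hwe (lt_of_le_of_ne ((lexAscending m).le_degree hw) fun h => hwd ?_)
    exact (lexAscending m).toSyn.injective h

theorem monomial_mem_initialIdeal_toricIdeal_iff {u : Fin m →₀ ℕ} :
    monomial u (1 : K) ∈ initialIdeal (lexAscending m) (toricIdeal K e) ↔
      ¬ IsStandard (fun i => (e i : Sym2 V)) u := by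
  rw [monomial_mem_initialIdeal_iff]
  constructor
  · rintro ⟨f, hf, h0, hle⟩ hu
    exact not_isStandard_degree hf h0 (hu.of_le hle)
  · intro hu
    simp only [IsStandard, not_forall, not_not] at hu
    obtain ⟨v, hv, hlt⟩ := hu
    exact ⟨_, (binomial_mem_toricIdeal_iff e).2 hv.symm,
      (monic_binomial (K := K) hlt).ne_zero, (degree_binomial hlt).le⟩

theorem exists_isMinimalNonstandard_le {ed : Fin m → Sym2 V} {u : Fin m →₀ ℕ}
    (hu : ¬ IsStandard ed u) : ∃ v ≤ u, IsMinimalNonstandard ed v := by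
  obtain ⟨v, ⟨hvu, hv⟩, hmin⟩ := (wellFounded_lt (α := Fin m →₀ ℕ)).has_min
    {v | v ≤ u ∧ ¬ IsStandard ed v} ⟨u, le_rfl, hu⟩
  refine ⟨v, hvu, hv, fun w hw hne => ?_⟩
  by_contra hstd
  exact hmin w ⟨hw.trans hvu, hstd⟩ (lt_of_le_of_ne hw hne)

/-- The standard monomial in the fibre of a monomial. -/
noncomputable def normalForm (ed : Fin m → Sym2 V) (u : Fin m →₀ ℕ) : Fin m →₀ ℕ :=
  (exists_isStandard ed u).choose

theorem vertexDegree_normalForm (ed : Fin m → Sym2 V) (u : Fin m →₀ ℕ) :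
    vertexDegree ed (normalForm ed u) = vertexDegree ed u :=
  (exists_isStandard ed u).choose_spec.1

theorem isStandard_normalForm (ed : Fin m → Sym2 V) (u : Fin m →₀ ℕ) :
    IsStandard ed (normalForm ed u) :=
  (exists_isStandard ed u).choose_spec.2

theorem normalForm_lt {ed : Fin m → Sym2 V} {u : Fin m →₀ ℕ} (hu : ¬ IsStandard ed u) :
    normalForm ed u ≺[lexAscending m] u := by
  rcases lt_trichotomy ((lexAscending m).toSyn (normalForm ed u)) ((lexAscending m).toSyn u)
    with h | h | h
  · exact h
  · rw [← (lexAscending m).toSyn.injective h] at hu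
    exact (hu (isStandard_normalForm ed u)).elim
  · exact (isStandard_normalForm ed u u (vertexDegree_normalForm ed u).symm h).elim

variable (K) in
/-- The binomials whose leading monomials minimally generate the initial ideal and whose trailing
monomials are standard. -/
noncomputable def reducedBinomials (ed : Fin m → Sym2 V) : Set (MvPolynomial (Fin m) K) :=
  (fun u => monomial u 1 - monomial (normalForm ed u) 1) '' {u | IsMinimalNonstandard ed u}

theorem isReducedGroebnerBasis_reducedBinomials :
    IsReducedGroebnerBasis (lexAscending m) (toricIdeal K e)
      (reducedBinomials K fun i => (e i : Sym2 V)) := by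
  set ed : Fin m → Sym2 V := fun i => (e i : Sym2 V) with hed
  have hmonic : ∀ b ∈ reducedBinomials K ed, (lexAscending m).Monic b := by
    rintro _ ⟨u, hu, rfl⟩
    exact monic_binomial (normalForm_lt hu.1)
  have hdeg : ∀ u, IsMinimalNonstandard ed u →
      (lexAscending m).degree (monomial u (1 : K) - monomial (normalForm ed u) 1) = u :=
    fun u hu => degree_binomial (normalForm_lt hu.1)
  refine ⟨Set.Finite.image _ ?_, ?_, hmonic, le_antisymm ?_ ?_, ?_, ?_⟩
  · refine WellQuasiOrderedLE.finite_of_isAntichain fun u hu v hv hne hle => ?_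
    exact hu.1 (hv.2 u hle hne)
  · rintro _ ⟨u, hu, rfl⟩
    exact (binomial_mem_toricIdeal_iff e).2 (vertexDegree_normalForm ed u).symm
  · refine Ideal.span_mono (Set.image_mono ?_)
    rintro _ ⟨u, hu, rfl⟩
    exact (binomial_mem_toricIdeal_iff e).2 (vertexDegree_normalForm ed u).symm
  · rw [initialIdeal_eq_span, image_leadingTerm_of_monic hmonic]
    refine Ideal.span_le.2 ?_
    rintro _ ⟨_, ⟨f, hf, h0, rfl⟩, rfl⟩
    obtain ⟨v, hle, hv⟩ := exists_isMinimalNonstandard_le (not_isStandard_degree hf h0)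
    exact monomial_mem_span_iff.2 ⟨v, ⟨_, ⟨v, hv, rfl⟩, hdeg v hv⟩, hle⟩
  · intro b hb h
    rw [leadingTerm_of_monic (hmonic b hb),
      image_leadingTerm_of_monic fun x hx => hmonic x hx.1, monomial_mem_span_iff] at h
    obtain ⟨_, ⟨_, ⟨⟨v, hv, rfl⟩, hne⟩, rfl⟩, hle⟩ := h
    obtain ⟨u, hu, rfl⟩ := hb
    rw [hdeg v hv, hdeg u hu] at hle
    exact hv.1 (hu.2 v hle fun e => hne (by rw [e]; rfl))
  · rintro _ ⟨u, hu, rfl⟩ w hw hne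
    rw [monomial_mem_initialIdeal_toricIdeal_iff, not_not]
    have huv : u ≠ normalForm ed u := fun h => hu.1 (h ▸ isStandard_normalForm ed u)
    change w ≠ (lexAscending m).degree (monomial u (1 : K) - monomial (normalForm ed u) 1) at hne
    rw [hdeg u hu] at hne
    rw [mem_support_binomial huv] at hw
    rcases hw with rfl | rfl
    · exact (hne rfl).elim
    · exact isStandard_normalForm ed u

/-- If the variables of `y^s - y^t` lie on the walk, then `s - t` is a multiple of the alternating
relation. Multiple zero means `s = t`; any other multiple involves every edge of the walk. -/
theorem isCircuit_of_isTightWalk {q : ℕ} {p r : ℕ → V} {α β : ℕ → Fin m}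
    (W : IsTightWalk (fun i => (e i : Sym2 V)) q p r α β)
    (hd : ∀ i, ¬ (e i : Sym2 V).IsDiag) (H : HasJoiningEdges fun i => (e i : Sym2 V))
    {u v : Fin m →₀ ℕ} (hu : u = ∑ k ∈ Finset.range q, Finsupp.single (α k) 1)
    (hv : v = ∑ k ∈ Finset.range q, Finsupp.single (β k) 1) (huv : ∀ i, u i = 0 ∨ v i = 0)
    (hD : vertexDegree (fun i => (e i : Sym2 V)) u = vertexDegree (fun i => (e i : Sym2 V)) v) :
    IsCircuit (toricIdeal K e) (monomial u (1 : K) - monomial v 1) := by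
  have huα : ∀ k < q, u (α k) ≠ 0 := fun k hk => by
    rw [hu]; exact sum_single_ne_zero (Finset.mem_range.2 hk)
  have hvβ : ∀ k < q, v (β k) ≠ 0 := fun k hk => by
    rw [hv]; exact sum_single_ne_zero (Finset.mem_range.2 hk)
  have hu1 : u (α 0) = 1 := by
    have h1 := huα 0 W.pos
    have h2 := sum_single_le_one (γ := α) (fun i hi j hj => W.left_injOn hd H hi hj) (α 0)
    rw [← hu] at h2
    omega
  have hne : u ≠ v := by
    rintro rfl
    have := huv (α 0)
    omega
  refine ⟨(binomial_mem_toricIdeal_iff e).2 hD, ⟨u, v, hne, rfl⟩, irreducible_binomial hu1 huv, ?_⟩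
  rintro _ hI ⟨s, t, hst, rfl⟩ ⟨hsub, hnsub⟩
  rw [binomial_mem_toricIdeal_iff] at hI
  have hmem : ∀ i, (s i : ℤ) - t i ≠ 0 → i ∈ (monomial s (1 : K) - monomial t 1).vars := by
    intro i hi
    rw [mem_vars_binomial hst]
    by_contra! h
    simp [h] at hi
  have hcover : ∀ i, (u i ≠ 0 ∨ v i ≠ 0) → ∃ k < q, α k = i ∨ β k = i := by
    rintro i (h | h)
    · rw [hu, sum_single_ne_zero_iff] at h
      obtain ⟨k, hk, h⟩ := h
      exact ⟨k, hk, Or.inl h⟩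
    · rw [hv, sum_single_ne_zero_iff] at h
      obtain ⟨k, hk, h⟩ := h
      exact ⟨k, hk, Or.inr h⟩
  have hcoeff := W.coeff_eq hd H (c := fun i => (s i : ℤ) - t i)
    (fun i hi j hj h => by
      have h1 := huα i hi
      have h2 := hvβ j hj
      rw [← h] at h2
      exact (huv _).elim h1 h2)
    (fun i hi => hcover i ((mem_vars_binomial hne).1 (hsub (hmem i hi))))
    (fun x => by
      have := congrArg (Nat.cast : ℕ → ℤ) (DFunLike.congr_fun hI x)
      rw [vertexDegree_apply, vertexDegree_apply] at this
      push_cast at this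
      simp only [sub_mul, Finset.sum_sub_distrib]
      exact sub_eq_zero.2 this)
  by_cases hc : (s (α 0) : ℤ) - t (α 0) = 0
  · refine hst (Finsupp.ext fun i => ?_)
    by_contra hi
    have hi' : (s i : ℤ) - t i ≠ 0 := by omega
    obtain ⟨k, hk, rfl | rfl⟩ := hcover i ((mem_vars_binomial hne).1 (hsub (hmem i hi')))
    · exact hi' ((hcoeff k hk).1.trans hc)
    · exact hi' ((hcoeff k hk).2.trans (neg_eq_zero.2 hc))
  · refine hnsub fun i hi => ?_
    obtain ⟨k, hk, rfl | rfl⟩ := hcover i ((mem_vars_binomial hne).1 hi)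
    · exact hmem _ fun h => hc ((hcoeff k hk).1.symm.trans h)
    · exact hmem _ fun h => hc (neg_eq_zero.1 ((hcoeff k hk).2.symm.trans h))

end ToricIdeal

end EdgeToric

theorem theorem3p3 {K : Type*} [Field K] {V : Type*} [Fintype V] (G : SimpleGraph V)
    (hres : EdgeToric.HasLinearResolution 2 (EdgeToric.edgeIdeal K G))
    {m : ℕ} (e : Fin m ≃ G.edgeSet)
    (hlq : EdgeToric.IsLinearQuotientOrdering (EdgeToric.edgeIdeal K G)
      (fun i => EdgeToric.edgeMonomial K (e i : Sym2 V))) :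
    ∃ B : Set (MvPolynomial (Fin m) K),
      EdgeToric.IsReducedGroebnerBasis (EdgeToric.lexAscending m)
        (EdgeToric.toricIdeal K e) B ∧
      (∀ B', EdgeToric.IsReducedGroebnerBasis (EdgeToric.lexAscending m)
        (EdgeToric.toricIdeal K e) B' → B' = B) ∧
      EdgeToric.IsDoublySquarefree B ∧
      ∀ b ∈ B, EdgeToric.IsCircuit (EdgeToric.toricIdeal K e) b := by
  have hd : ∀ i, ¬ (e i : Sym2 V).IsDiag := fun i => G.not_isDiag_of_mem_edgeSet (e i).2
  have H := hlq.hasJoiningEdges (Subtype.val_injective.comp e.injective) hd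
  have hB := EdgeToric.isReducedGroebnerBasis_reducedBinomials (K := K) (e := e)
  refine ⟨_, hB, fun B' hB' => hB'.unique hB, ?_, ?_⟩
  · rintro _ ⟨u, hu, rfl⟩ w hw i
    have hstd := EdgeToric.isStandard_normalForm (fun i => (e i : Sym2 V)) u
    obtain ⟨q, p, r, α, β, W, hα, hβ⟩ := hu.exists_isTightWalk hstd
      (EdgeToric.vertexDegree_normalForm _ u).symm
    have huv : u ≠ EdgeToric.normalForm (fun i => (e i : Sym2 V)) u :=
      fun h => hu.1 (h ▸ hstd)
    rw [EdgeToric.mem_support_binomial huv] at hw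
    rcases hw with rfl | rfl
    · rw [hα]
      exact EdgeToric.sum_single_le_one (fun i hi j hj => W.left_injOn hd H hi hj) i
    · rw [hβ]
      exact EdgeToric.sum_single_le_one (fun i hi j hj => W.right_injOn hd H hi hj) i
  · rintro _ ⟨u, hu, rfl⟩
    have hstd := EdgeToric.isStandard_normalForm (fun i => (e i : Sym2 V)) u
    have hdeg := (EdgeToric.vertexDegree_normalForm (fun i => (e i : Sym2 V)) u).symm
    obtain ⟨q, p, r, α, β, W, hα, hβ⟩ := hu.exists_isTightWalk hstd hdeg
    exact EdgeToric.isCircuit_of_isTightWalk W hd H hα hβ (hu.coprime hstd hdeg) hdeg
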